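/- Let $k$ be a field and let $2\le a<b\le d-2$ be integers. Let $R=k[x^{\alpha}y^{d-\alpha} : \alpha\in\{0,d\}\cup[a,b]]\subseteq k[x,y]$, where $[a,b]$ denotes the set of integers $\alpha$ with $a\le\alpha\le b$, graded so that the given monomial generators have degree $1$. Let $R_+$ be the ideal of $R$ generated by the homogeneous elements of positive degree, and let $Q=(x^d,y^d)R$. Denote by $r_Q(R_+)$ the reduction number of $R_+$ with respect to $Q$, i.e. the least $r\ge 0$ with $Q\,R_+^{\,r}=R_+^{\,r+1}$. Denote by $\operatorname{reg}(R)$ the Castelnuovo–Mumford regularity of $R$, i.e. $\max_i\{b_i-i\}$, where $b_i$ is the maximal degree of the generators of the $i$-th module $F_i$ in a minimal graded free resolution $0\to F_p\to\cdots\to F_0\to R\to 0$ of $R$ over the standard graded polynomial ring $S=k[T_\alpha : \alpha\in\{0,d\}\cup[a,b]]$, which acts on $R$ through $T_\alpha\mapsto x^\alpha y^{d-\alpha}$. Then $R$ is a Cohen–Macaulay ring, and \begin{enumerate} \item[(1)] $\operatorname{reg}(R)=r_Q(R_+)=\left\lceil\dfrac{a+d-1}{b}\right\rceil$ if $b\ge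 2a-1$; \item[(2)] $\operatorname{reg}(R)=r_Q(R_+)=\left\lceil\dfrac{2a+d-1}{b}\right\rceil$ if $\dfrac{3a-1}{2}\le b<2a-1$. \end{enumerate} -/

import Mathlib

open MvPolynomial

/-- A (Noetherian) local ring is Cohen–Macaulay if it admits a regular sequence whose length is
its Krull dimension. (`IsRegular A rs` contains `(rs) ≠ A`, so that `rs` lies in the maximal
ideal.) -/
def IsCohenMacaulayLocalRing (A : Type*) [CommRing A] [IsLocalRing A] : Prop :=
  IsNoetherianRing A ∧
    ∃ rs : List A, RingTheory.Sequence.IsRegular A rs ∧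
      ((rs.length : ℕ∞) : WithBot ℕ∞) = ringKrullDim A

/-- A ring is Cohen–Macaulay if it is Noetherian and its localizations at all maximal ideals are
Cohen–Macaulay local rings. -/
def IsCohenMacaulayRing (A : Type*) [CommRing A] : Prop :=
  IsNoetherianRing A ∧
    ∀ (m : Ideal A) [m.IsMaximal], IsCohenMacaulayLocalRing (Localization.AtPrime m)

/-- `r = r_J(I)`: the ideal `J ⊆ I` is a reduction of `I`, and `r` is the least natural number with
`J I ^ r = I ^ (r + 1)`. -/
def IsReductionNumber {A : Type*} [CommRing A] (J I : Ideal A) (r : ℕ) : Prop :=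
  J ≤ I ∧ IsLeast {n : ℕ | J * I ^ n = I ^ (n + 1)} r

/-- A finite minimal graded free resolution `0 → F_p → ⋯ → F_0 → R → 0` of a graded `k`-algebra `R`
(with graded pieces `𝒜 n`) over the standard graded polynomial ring `S = k[T_s : s ∈ σ]`, where
`R` is an `S`-module through `φ : S → R`. The graded free module `F_i` is `S ^ (rank i)`, whose
`j`-th basis vector has degree `deg i j`. -/
structure MinimalGradedFreeResolution {σ k R : Type*} [Field k] [CommRing R] [Algebra k R]
    (φ : MvPolynomial σ k →ₐ[k] R) (𝒜 : ℕ → Submodule k R) where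
  /-- the index `p` of the last module -/
  length : ℕ
  /-- the number of basis vectors of `F_i` -/
  rank : ℕ → ℕ
  /-- the degrees of the basis vectors of `F_i` -/
  deg : (i : ℕ) → Fin (rank i) → ℕ
  /-- the differential `F_{i+1} → F_i` -/
  diff : (i : ℕ) →
    (Fin (rank (i + 1)) → MvPolynomial σ k) →ₗ[MvPolynomial σ k] (Fin (rank i) → MvPolynomial σ k)
  /-- the augmentation `F_0 → R` -/
  aug : (Fin (rank 0) → MvPolynomial σ k) →ₛₗ[(φ : MvPolynomial σ k →+* R)] R
  rank_eq_zero : ∀ i, length < i → rank i = 0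
  /-- the augmentation preserves degrees -/
  aug_homogeneous : ∀ j, aug (Pi.single j 1) ∈ 𝒜 (deg 0 j)
  /-- the differentials preserve degrees -/
  diff_homogeneous : ∀ i j l, diff i (Pi.single j 1) l = 0 ∨
    ∃ n, deg i l + n = deg (i + 1) j ∧ (diff i (Pi.single j 1) l).IsHomogeneous n
  aug_surjective : Function.Surjective aug
  exact_zero : LinearMap.ker aug = LinearMap.range (diff 0)
  exact_succ : ∀ i, LinearMap.ker (diff i) = LinearMap.range (diff (i + 1))
  /-- minimality: the entries of the matrices lie in the ideal generated by the variables -/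
  minimal : ∀ i j l, constantCoeff (diff i (Pi.single j 1) l) = 0

/-- `r = max {b_i - i}`, where `b_i` is the maximal degree of the generators of `F_i` in the minimal
graded free resolution of `R` over `k[T_s : s ∈ σ]` (which exists; the value is the same for each
such resolution). -/
def IsCastelnuovoMumfordRegularity {σ k R : Type*} [Field k] [CommRing R] [Algebra k R]
    (φ : MvPolynomial σ k →ₐ[k] R) (𝒜 : ℕ → Submodule k R) (r : ℤ) : Prop :=
  Nonempty (MinimalGradedFreeResolution φ 𝒜) ∧
    ∀ F : MinimalGradedFreeResolution φ 𝒜,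
      IsGreatest {c : ℤ | ∃ (i : ℕ) (j : Fin (F.rank i)), c = (F.deg i j : ℤ) - i} r

namespace MonomialCurve

/-- The monomial `x ^ α * y ^ (d - α)` of `k[x, y]`, for `α ≤ d`. -/
noncomputable def mon (k : Type*) [Field k] (d α : ℕ) : MvPolynomial (Fin 2) k :=
  X 0 ^ α * X 1 ^ (d - α)

/-- The algebra `k[x ^ α * y ^ (d - α) : α ∈ M]`, for a finite set `M ⊆ {0, …, d}`. -/
noncomputable def ring (k : Type*) [Field k] (d : ℕ) (M : Finset ℕ) :
    Subalgebra k (MvPolynomial (Fin 2) k) :=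
  Algebra.adjoin k (mon k d '' (M : Set ℕ))

variable (k : Type*) [Field k] (d : ℕ) (M : Finset ℕ)

/-- The graded piece `R_n`: the elements of `R` that are forms of degree `n * d` in `x, y`. -/
noncomputable def piece (n : ℕ) : Submodule k (ring k d M) :=
  (homogeneousSubmodule (Fin 2) k (n * d)).comap (ring k d M).val.toLinearMap

/-- The ideal `R_+`, generated by the elements of positive degree. -/
noncomputable def irrelevant : Ideal (ring k d M) :=
  Ideal.span {f | ∃ n : ℕ, 1 ≤ n ∧ f ∈ piece k d M n}

/-- The ideal `Q = (x ^ d, y ^ d)` of `R`. -/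
noncomputable def Q : Ideal (ring k d M) :=
  Ideal.span {f | (f : MvPolynomial (Fin 2) k) = X 0 ^ d ∨ (f : MvPolynomial (Fin 2) k) = X 1 ^ d}

/-- The presentation `k[T_α : α ∈ M] → R`, `T_α ↦ x ^ α * y ^ (d - α)`. -/
noncomputable def presentation : MvPolynomial {α // α ∈ M} k →ₐ[k] ring k d M :=
  aeval fun α => ⟨mon k d α, Algebra.subset_adjoin (Set.mem_image_of_mem _ α.2)⟩

/-- `r = reg R`. -/
def IsReg (r : ℤ) : Prop :=
  IsCastelnuovoMumfordRegularity (presentation k d M) (piece k d M) r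

/-- `r = r_Q(R_+)`. -/
def IsRedNumber (r : ℕ) : Prop :=
  IsReductionNumber (Q k d M) (irrelevant k d M) r

/-- The exponents `{0, d} ∪ [a, b]`. -/
def exponents (a b d : ℕ) : Finset ℕ := {0, d} ∪ Finset.Icc a b

end MonomialCurve

/-! Write nM for the set of sums of n elements of M = {0, d} ∪ [a, b]. The degree n part of R has as
basis the monomials x^u y^(nd-u) with u in nM, so everything is read off from the sets nM. By
`isSum_exponents_iff`, nM is the union of the intervals [ia + jd, ib + jd] with i + j ≤ n.

If u and u + d both lie in (n+1)M, then u lies in nM (`exponents_cancel`). Algebraically, x^d is a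
nonzerodivisor modulo y^d, so the Koszul complex of R on x^d, y^d has only the homology R/Q. Let e
be the top degree of R/Q. When the other variables are added one at a time, the long exact sequences
of the mapping cones create no homology in coefficient degree above e, and a nonzero class in degree
e survives, moving up one homological degree each time. Koszul homology on all variables gives the
degrees in a minimal resolution (`exists_deg_eq_iff`), so reg R = e. Moreover R_+^n is spanned by
the monomials of degree at least n (`irrelevant_pow`), so Q R_+^n = R_+^(n+1) holds for n = e and
fails for n < e.

It remains to find e. A monomial of degree n+1 outside Q needs n+1 summands from [a, b], so nb < u ≤
(n+1)b, and u - d must avoid nM. The intervals [ia, ib] cover all integers from g on, where g = a in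
case (1) and g = 2a in case (2), and they miss g - 1. Hence nothing is left once nb + 1 ≥ d + g,
while u = d + g - 1 shows sharpness, and e is the ceiling of (d + g - 1)/b. If d = 2a - 1 in case
(2), then d + g - 1 = 2d is useless and u = d + 2a - 2 replaces it.

For Cohen–Macaulayness, each maximal ideal contains some monic f(x^d) and g(y^d). The cancellation
property makes them a regular sequence (`isWeaklyRegular_aeval`), and every prime containing both is
maximal. -/

/-! ### The Koszul complex as an iterated mapping cone -/

/-- An abelian group with commuting operators `x s`, graded so that the operators have degree `1`. -/
structure OperatorGrading (σ N : Type*) [AddCommGroup N] where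
  x : σ → N →+ N
  deg : ℤ → AddSubgroup N
  comm : ∀ s t n, x s (x t n) = x t (x s n)
  x_mem : ∀ s a n, n ∈ deg a → x s n ∈ deg (a + 1)

namespace Koszul

variable {σ : Type*}

/-- The underlying group of the Koszul complex on a list of operators. -/
def Carrier (N : Type*) : List σ → Type _
  | [] => N
  | _ :: l => Carrier N l × Carrier N l

instance instAddCommGroup (N : Type*) [AddCommGroup N] : ∀ l : List σ, AddCommGroup (Carrier N l)
  | [] => inferInstanceAs (AddCommGroup N)
  | _ :: l =>
    letI := instAddCommGroup N l
    inferInstanceAs (AddCommGroup (Carrier N l × Carrier N l))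

variable {N N' F : Type*} [AddCommGroup N] [AddCommGroup N'] [AddCommGroup F]

/-- Functoriality of the Koszul complex. -/
def map (f : N →+ N') : ∀ l : List σ, Carrier N l →+ Carrier N' l
  | [] => f
  | _ :: l => (map f l).prodMap (map f l)

/-- The embedding of the group as the part of homological degree zero. -/
def incl : ∀ l : List σ, N →+ Carrier N l
  | [] => AddMonoidHom.id N
  | _ :: l => (AddMonoidHom.inl (Carrier N l) (Carrier N l)).comp (incl l)

/-- The Koszul differential. -/
def d (x : σ → N →+ N) : ∀ l : List σ, Carrier N l →+ Carrier N l
  | [] => 0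
  | s :: l => ((d x l).comp (AddMonoidHom.fst (Carrier N l) (Carrier N l)) +
      (map (x s) l).comp (AddMonoidHom.snd (Carrier N l) (Carrier N l))).prod
        (-(d x l).comp (AddMonoidHom.snd (Carrier N l) (Carrier N l)))

/-- The part of homological degree `i` with coefficients of degree `a`. -/
def strand (D : ℤ → AddSubgroup N) : ∀ l : List σ, ℤ → ℤ → AddSubgroup (Carrier N l)
  | [], i, a => if i = 0 then D a else (⊥ : AddSubgroup N)
  | _ :: l, i, a => (strand D l i a).prod (strand D l (i - 1) a)

theorem map_cons (f : N →+ N') (s : σ) (l : List σ) (u v : Carrier N l) :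
    map f (s :: l) (u, v) = (map f l u, map f l v) := rfl

theorem d_cons (x : σ → N →+ N) (s : σ) (l : List σ) (u v : Carrier N l) :
    d x (s :: l) (u, v) = (d x l u + map (x s) l v, -d x l v) := rfl

theorem mem_strand_cons (D : ℤ → AddSubgroup N) (s : σ) (l : List σ) (i a : ℤ)
    (u v : Carrier N l) : (show Carrier N (s :: l) from (u, v)) ∈ strand D (s :: l) i a ↔
      u ∈ strand D l i a ∧ v ∈ strand D l (i - 1) a := Iff.rfl

theorem mem_strand_nil_zero (D : ℤ → AddSubgroup N) (a : ℤ) (u : N) :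
    (show Carrier N ([] : List σ) from u) ∈ strand D [] 0 a ↔ u ∈ D a := by
  simp only [strand]; rfl

theorem mem_strand_nil_of_ne (D : ℤ → AddSubgroup N) {i : ℤ} (hi : i ≠ 0) (a : ℤ)
    (u : Carrier N ([] : List σ)) : u ∈ strand D [] i a ↔ u = 0 := by
  have : strand D ([] : List σ) i a = (⊥ : AddSubgroup N) := if_neg hi
  rw [this]; exact AddSubgroup.mem_bot (G := N)

theorem incl_cons (s : σ) (l : List σ) (n : N) : incl (s :: l) n = (incl l n, 0) := rfl

theorem cons_zero (s : σ) (l : List σ) : (0 : Carrier N (s :: l)) = ((0, 0) : _ × _) := rfl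

theorem map_map {f : N →+ N'} {x : N →+ N} {x' : N' →+ N'} (h : ∀ n, f (x n) = x' (f n))
    (l : List σ) (u : Carrier N l) : map f l (map x l u) = map x' l (map f l u) := by
  induction l with
  | nil => exact h u
  | cons s l ih => obtain ⟨u, v⟩ := u; simp only [map_cons, ih]; rfl

theorem map_d {f : N →+ N'} {x : σ → N →+ N} {x' : σ → N' →+ N'}
    (h : ∀ s n, f (x s n) = x' s (f n)) (l : List σ) (u : Carrier N l) :
    map f l (d x l u) = d x' l (map f l u) := by
  induction l with
  | nil => exact map_zero f
  | cons s l ih =>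
    obtain ⟨u, v⟩ := u
    simp only [map_cons, d_cons, ih, map_add, map_neg, map_map (h s)]
    rfl

theorem d_d {x : σ → N →+ N} (h : ∀ s t n, x s (x t n) = x t (x s n)) (l : List σ)
    (u : Carrier N l) : d x l (d x l u) = 0 := by
  induction l with
  | nil => rfl
  | cons s l ih =>
    obtain ⟨u, v⟩ := u
    simp only [d_cons, ih, map_add, map_neg, map_d (x := x) (x' := x) (fun t n => h s t n), cons_zero]
    simp
    rfl

theorem map_incl (f : N →+ N') (l : List σ) (n : N) : map f l (incl l n) = incl l (f n) := by
  induction l with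
  | nil => rfl
  | cons s l ih => simp only [incl_cons, map_cons, ih, map_zero]; rfl

theorem map_mem_strand {f : N →+ N'} {D : ℤ → AddSubgroup N} {D' : ℤ → AddSubgroup N'} {e a : ℤ}
    (h : ∀ n ∈ D a, f n ∈ D' e) (l : List σ) (i : ℤ) {u : Carrier N l}
    (hu : u ∈ strand D l i a) : map f l u ∈ strand D' l i e := by
  induction l generalizing i with
  | nil =>
    by_cases hi : i = 0
    · subst hi
      exact (mem_strand_nil_zero D' _ _).2 (h u ((mem_strand_nil_zero D _ _).1 hu))
    · rw [(mem_strand_nil_of_ne D hi _ _).1 hu, map_zero]; exact zero_mem _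
  | cons s l ih => exact ⟨ih _ hu.1, ih _ hu.2⟩

theorem strand_eq_bot_of_neg (D : ℤ → AddSubgroup N) (l : List σ) {i : ℤ} (hi : i < 0) (a : ℤ)
    {u : Carrier N l} (hu : u ∈ strand D l i a) : u = 0 := by
  induction l generalizing i with
  | nil => simp only [strand, hi.ne] at hu; exact hu
  | cons s l ih => exact Prod.ext (ih hi hu.1) (ih (by omega) hu.2)

theorem strand_eq_bot_of_length_lt (D : ℤ → AddSubgroup N) (l : List σ) {i : ℤ}
    (hi : (l.length : ℤ) < i) (a : ℤ) {u : Carrier N l} (hu : u ∈ strand D l i a) : u = 0 := by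
  induction l generalizing i with
  | nil =>
    have : i ≠ 0 := by simp at hi; omega
    simp only [strand, this] at hu; exact hu
  | cons s l ih =>
    simp only [List.length_cons, Nat.cast_add, Nat.cast_one] at hi
    exact Prod.ext (ih (by omega) hu.1) (ih (by omega) hu.2)

theorem mem_strand_zero_iff (D : ℤ → AddSubgroup N) (l : List σ) (a : ℤ) {u : Carrier N l} :
    u ∈ strand D l 0 a ↔ ∃ n ∈ D a, u = incl l n := by
  induction l with
  | nil => simp only [strand]; exact ⟨fun h => ⟨u, h, rfl⟩, fun ⟨n, h, e⟩ => e ▸ h⟩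
  | cons s l ih =>
    obtain ⟨u, v⟩ := u
    rw [mem_strand_cons, ih]
    constructor
    · rintro ⟨⟨n, hn, rfl⟩, hv⟩
      exact ⟨n, hn, Prod.ext rfl (strand_eq_bot_of_neg D l (by norm_num) a hv)⟩
    · rintro ⟨n, hn, h⟩
      refine ⟨⟨n, hn, congrArg Prod.fst h⟩, ?_⟩
      have : v = 0 := congrArg Prod.snd h
      rw [this]; exact zero_mem _

/-- The Koszul complex is a finite direct sum of copies of its coefficients, so exactness in the
coefficients passes to it degree by degree. -/
theorem exists_map_eq_of_surjOn {g : F →+ N} {D : ℤ → AddSubgroup F} {D' : ℤ → AddSubgroup N}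
    (h : ∀ a, ∀ n ∈ D' a, ∃ v ∈ D a, g v = n) (l : List σ) (i a : ℤ) {u : Carrier N l}
    (hu : u ∈ strand D' l i a) : ∃ v ∈ strand D l i a, map g l v = u := by
  induction l generalizing i with
  | nil =>
    by_cases hi : i = 0
    · subst hi
      obtain ⟨v, hv, e⟩ := h a u ((mem_strand_nil_zero D' _ _).1 hu)
      exact ⟨v, (mem_strand_nil_zero D _ _).2 hv, e⟩
    · exact ⟨0, zero_mem _, by rw [(mem_strand_nil_of_ne D' hi _ _).1 hu, map_zero]⟩
  | cons s l ih =>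
    obtain ⟨v, hv, h1⟩ := ih _ hu.1
    obtain ⟨w, hw, h2⟩ := ih _ hu.2
    exact ⟨(v, w), ⟨hv, hw⟩, Prod.ext h1 h2⟩

theorem exists_map_eq_of_map_eq_zero {f : N' →+ F} {g : F →+ N} {D : ℤ → AddSubgroup F}
    {D' : ℤ → AddSubgroup N'} (h : ∀ a, ∀ v ∈ D a, g v = 0 → ∃ n ∈ D' a, f n = v)
    (l : List σ) (i a : ℤ) {u : Carrier F l} (hu : u ∈ strand D l i a) (h0 : map g l u = 0) :
    ∃ v ∈ strand D' l i a, map f l v = u := by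
  induction l generalizing i with
  | nil =>
    by_cases hi : i = 0
    · subst hi
      obtain ⟨v, hv, e⟩ := h a u ((mem_strand_nil_zero D _ _).1 hu) h0
      exact ⟨v, (mem_strand_nil_zero D' _ _).2 hv, e⟩
    · exact ⟨0, zero_mem _, by rw [(mem_strand_nil_of_ne D hi _ _).1 hu, map_zero]⟩
  | cons s l ih =>
    obtain ⟨v, hv, h1⟩ := ih _ hu.1 (congrArg Prod.fst h0)
    obtain ⟨w, hw, h2⟩ := ih _ hu.2 (congrArg Prod.snd h0)
    exact ⟨(v, w), ⟨hv, hw⟩, Prod.ext h1 h2⟩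

theorem map_injective {f : N →+ N'} (h : Function.Injective f) (l : List σ) :
    Function.Injective (map f l) := by
  induction l with
  | nil => exact h
  | cons s l ih => exact ih.prodMap ih

theorem map_comp_eq_zero {f : N' →+ F} {g : F →+ N} (h : ∀ n, g (f n) = 0) (l : List σ)
    (u : Carrier N' l) : map g l (map f l u) = 0 := by
  induction l with
  | nil => exact h u
  | cons s l ih => exact Prod.ext (ih _) (ih _)

end Koszul

/-! ### Vanishing of Koszul homology -/

namespace OperatorGrading

open Koszul

variable {σ : Type*} {N N' F : Type*} [AddCommGroup N] [AddCommGroup N'] [AddCommGroup F]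

section

variable (G : OperatorGrading σ N)

theorem d_mem_strand (l : List σ) (i a : ℤ) {u : Carrier N l} (hu : u ∈ strand G.deg l i a) :
    d G.x l u ∈ strand G.deg l (i - 1) (a + 1) := by
  induction l generalizing i with
  | nil => exact zero_mem _
  | cons s l ih =>
    exact (mem_strand_cons _ s l _ _ _ _).2
      ⟨add_mem (ih _ hu.1) (map_mem_strand (G.x_mem s a) l _ hu.2), neg_mem (ih _ hu.2)⟩

/-- The Koszul homology on `l` vanishes in homological degree `i` and internal degree `i + a`. -/
def Vanishes (l : List σ) (i a : ℤ) : Prop :=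
  ∀ u ∈ strand G.deg l i a, d G.x l u = 0 → ∃ w ∈ strand G.deg l (i + 1) (a - 1), d G.x l w = u

/-- The degree `a` part of the subgroup generated by the images of the operators in `l`. -/
def boundary (l : List σ) (a : ℤ) : AddSubgroup N :=
  ⨆ s ∈ l, (G.deg (a - 1)).map (G.x s)

theorem boundary_nil (a : ℤ) : G.boundary [] a = ⊥ := by simp [boundary]

theorem boundary_cons (s : σ) (l : List σ) (a : ℤ) :
    G.boundary (s :: l) a = G.boundary l a ⊔ (G.deg (a - 1)).map (G.x s) := by
  rw [boundary, boundary, sup_comm]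
  simp [iSup_or, iSup_sup_eq]

variable {G}

/-- If v = d w, adding the boundary of (0, w) to (u, v) leaves (u + x_s w, 0), which is a cycle of
the complex on `l` and hence a boundary there. -/
theorem exists_d_eq_of_snd {s : σ} {l : List σ} {i a : ℤ} (h : G.Vanishes l i a)
    {u v : Carrier N l} (hu : u ∈ strand G.deg l i a) (h0 : d G.x l u + map (G.x s) l v = 0)
    (hv : ∃ w ∈ strand G.deg l i (a - 1), d G.x l w = v) :
    ∃ w ∈ strand G.deg (s :: l) (i + 1) (a - 1), d G.x (s :: l) w = (u, v) := by
  obtain ⟨w, hw, rfl⟩ := hv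
  have hxw : map (G.x s) l w ∈ strand G.deg l i a := by
    have := map_mem_strand (G.x_mem s (a - 1)) l i hw
    rwa [sub_add_cancel] at this
  rw [map_d (x := G.x) (x' := G.x) (G.comm s), ← map_add] at h0
  obtain ⟨y, hy, hy'⟩ := h _ (add_mem hu hxw) h0
  refine ⟨(y, -w), (mem_strand_cons _ s l _ _ _ _).2 ⟨hy, ?_⟩, ?_⟩
  · rw [add_sub_cancel_right]; exact neg_mem hw
  · rw [d_cons, hy']; simp; rfl

/-- Exactness of H_i(l) → H_i(s :: l) → H_{i-1}(l). -/
theorem Vanishes.cons {l : List σ} {i a : ℤ} (h : G.Vanishes l i a) (h' : G.Vanishes l (i - 1) a)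
    (s : σ) : G.Vanishes (s :: l) i a := by
  rintro ⟨u, v⟩ ⟨hu, hv⟩ h0
  rw [d_cons] at h0
  refine exists_d_eq_of_snd h hu (congrArg Prod.fst h0) ?_
  have := h' v hv (neg_eq_zero.1 (congrArg Prod.snd h0))
  rwa [sub_add_cancel] at this

/-- H_{i+1}(s :: l) maps onto the kernel of x_s on H_i(l). In coefficient degree a this kernel is
all of H_i(l), because x_s lands in degree a + 1, where the homology is zero. -/
theorem not_vanishes_cons {l : List σ} {i a : ℤ} (h : ¬ G.Vanishes l i a)
    (h' : G.Vanishes l i (a + 1)) (s : σ) : ¬ G.Vanishes (s :: l) (i + 1) a := by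
  intro H
  apply h
  intro v hv h0
  obtain ⟨u, hu, hu'⟩ := h' (map (G.x s) l v) (map_mem_strand (G.x_mem s a) l i hv)
    (by rw [← map_d (x := G.x) (x' := G.x) (G.comm s), h0, map_zero])
  rw [add_sub_cancel_right] at hu
  obtain ⟨⟨w, y⟩, hw, e⟩ := H (-u, v)
    ((mem_strand_cons _ s l _ _ _ _).2 ⟨neg_mem hu, by rw [add_sub_cancel_right]; exact hv⟩)
    (by rw [d_cons, map_neg, hu', h0, cons_zero]; simp; rfl)
  refine ⟨-y, neg_mem ?_, ?_⟩
  · have := hw.2; rwa [add_sub_cancel_right] at this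
  · rw [map_neg]; exact congrArg Prod.snd e

theorem vanishes_of_length_lt (l : List σ) {i : ℤ} (hi : (l.length : ℤ) < i) (a : ℤ) :
    G.Vanishes l i a :=
  fun _ hu _ => ⟨0, zero_mem _, by rw [map_zero, strand_eq_bot_of_length_lt _ l hi a hu]⟩

/-- This identifies H_0 with the quotient of the group by the images of the operators. -/
theorem exists_d_eq_incl_iff (l : List σ) (a : ℤ) (n : N) :
    (∃ w ∈ strand G.deg l 1 (a - 1), d G.x l w = incl l n) ↔ n ∈ G.boundary l a := by
  induction l generalizing n with
  | nil =>
    rw [boundary_nil]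
    constructor
    · rintro ⟨w, -, h⟩; exact h.symm
    · intro h; exact ⟨0, zero_mem _, h.symm⟩
  | cons s l ih =>
    rw [boundary_cons, AddSubgroup.mem_sup]
    constructor
    · rintro ⟨⟨u, v⟩, hw, e⟩
      rw [d_cons, incl_cons] at e
      obtain ⟨m, hm, rfl⟩ := (mem_strand_zero_iff _ l _).1 hw.2
      refine ⟨n - G.x s m, (ih _).1 ⟨u, hw.1, ?_⟩, _, ⟨m, hm, rfl⟩, sub_add_cancel _ _⟩
      rw [map_sub, ← map_incl]
      exact eq_sub_of_add_eq (congrArg Prod.fst e)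
    · rintro ⟨y, hy, _, ⟨m, hm, rfl⟩, rfl⟩
      obtain ⟨u, hu, e⟩ := (ih _).2 hy
      have hmem := (mem_strand_zero_iff G.deg l (a - 1)).2 ⟨m, hm, rfl⟩
      refine ⟨(u, incl l m), ⟨hu, hmem⟩, ?_⟩
      rw [d_cons, e, map_incl, incl_cons, map_add]
      refine Prod.ext rfl ?_
      rw [strand_eq_bot_of_neg _ l (by norm_num) _ (G.d_mem_strand l _ _ hmem)]
      exact neg_zero

theorem vanishes_zero_iff (l : List σ) (a : ℤ) : G.Vanishes l 0 a ↔ G.deg a ≤ G.boundary l a := by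
  constructor
  · intro h n hn
    have hmem := (mem_strand_zero_iff G.deg l a).2 ⟨n, hn, rfl⟩
    exact (exists_d_eq_incl_iff l a n).1 (h _ hmem
      (strand_eq_bot_of_neg _ l (by norm_num) _ (G.d_mem_strand l _ _ hmem)))
  · intro h u hu _
    obtain ⟨n, hn, rfl⟩ := (mem_strand_zero_iff _ l _).1 hu
    exact (exists_d_eq_incl_iff l a n).2 (h hn)

/-- A nonzerodivisor on the zeroth Koszul homology preserves acyclicity. -/
theorem acyclic_cons {s : σ} {l : List σ} (h : ∀ i a, i ≠ 0 → G.Vanishes l i a)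
    (hs : ∀ a, ∀ n ∈ G.deg a, G.x s n ∈ G.boundary l (a + 1) → n ∈ G.boundary l a) :
    ∀ i a, i ≠ 0 → G.Vanishes (s :: l) i a := by
  intro i a hi
  -- Only i = 1 involves H_0(l), on which x_s is injective. For other i both neighbouring groups
  -- vanish.
  by_cases hi1 : i = 1
  · subst hi1
    rintro ⟨u, v⟩ ⟨hu, hv⟩ h0
    rw [d_cons] at h0
    have h1 : d G.x l u + map (G.x s) l v = 0 := congrArg Prod.fst h0
    refine exists_d_eq_of_snd (h _ _ one_ne_zero) hu h1 ?_
    obtain ⟨n, hn, rfl⟩ := (mem_strand_zero_iff _ l _).1 hv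
    refine (exists_d_eq_incl_iff l a n).2 (hs a n hn ((exists_d_eq_incl_iff l _ _).1 ⟨-u, ?_, ?_⟩))
    · rw [add_sub_cancel_right]; exact neg_mem hu
    · rw [map_neg, ← map_incl]; exact neg_eq_of_add_eq_zero_right h1
  · exact (h i a hi).cons (h _ a (by omega)) s

theorem acyclic_nil : ∀ i a, i ≠ 0 → G.Vanishes [] i a := by
  intro i a hi u hu _
  simp only [strand, hi] at hu
  exact ⟨0, zero_mem _, by rw [map_zero]; exact hu.symm⟩

end

/-! ### Long exact sequences and dimension shifting -/

/-- A short exact sequence of graded groups with operators. -/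
structure ShortExact (G' : OperatorGrading σ N') (P : OperatorGrading σ F)
    (G : OperatorGrading σ N) where
  f : N' →+ F
  g : F →+ N
  f_x : ∀ s n, f (G'.x s n) = P.x s (f n)
  g_x : ∀ s n, g (P.x s n) = G.x s (g n)
  f_mem : ∀ a, ∀ n ∈ G'.deg a, f n ∈ P.deg a
  g_mem : ∀ a, ∀ n ∈ P.deg a, g n ∈ G.deg a
  injective : Function.Injective f
  comp : ∀ n, g (f n) = 0
  exact : ∀ a, ∀ v ∈ P.deg a, g v = 0 → ∃ n ∈ G'.deg a, f n = v
  surjOn : ∀ a, ∀ n ∈ G.deg a, ∃ v ∈ P.deg a, g v = n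

namespace ShortExact

variable {G' : OperatorGrading σ N'} {P : OperatorGrading σ F} {G : OperatorGrading σ N}
  (E : ShortExact G' P G)

include E

/-- Exactness of H_{i+1}(F) → H_{i+1}(N) → H_i(N'). The connecting map keeps the internal degree i +
a, so it raises the coefficient degree by one. -/
theorem vanishes_succ {l : List σ} {i a : ℤ} (h : G'.Vanishes l i (a + 1))
    (hP : P.Vanishes l (i + 1) a) : G.Vanishes l (i + 1) a := by
  intro u hu h0
  obtain ⟨v, hv, rfl⟩ := exists_map_eq_of_surjOn E.surjOn l _ _ hu
  have hdv := P.d_mem_strand l _ _ hv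
  rw [add_sub_cancel_right] at hdv
  rw [← map_d E.g_x] at h0
  obtain ⟨n, hn, e⟩ := exists_map_eq_of_map_eq_zero E.exact l _ _ hdv h0
  obtain ⟨w, hw, rfl⟩ := h n hn (map_injective E.injective l (by
    rw [map_d E.f_x, e, d_d P.comm, map_zero]))
  rw [add_sub_cancel_right] at hw
  obtain ⟨y, hy, e'⟩ := hP (v - map E.f l w) (sub_mem hv (map_mem_strand (E.f_mem a) l _ hw))
    (by rw [map_sub, ← e, map_d E.f_x, sub_self])
  refine ⟨map E.g l y, map_mem_strand (E.g_mem _) l _ hy, ?_⟩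
  rw [← map_d E.g_x, e', map_sub, map_comp_eq_zero E.comp, sub_zero]

/-- Exactness of H_{i+1}(N) → H_i(N') → H_i(F), with `hP` saying that the second map is zero. -/
theorem vanishes_of_succ {l : List σ} {i a : ℤ} (h : G.Vanishes l (i + 1) a)
    (hP : ∀ n ∈ strand G'.deg l i (a + 1), d G'.x l n = 0 →
      ∃ v ∈ strand P.deg l (i + 1) a, d P.x l v = map E.f l n) : G'.Vanishes l i (a + 1) := by
  intro n hn h0
  obtain ⟨v, hv, e⟩ := hP n hn h0
  obtain ⟨y, hy, e'⟩ := h _ (map_mem_strand (E.g_mem a) l _ hv)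
    (by rw [← map_d E.g_x, e, map_comp_eq_zero E.comp])
  obtain ⟨z, hz, rfl⟩ := exists_map_eq_of_surjOn E.surjOn l _ _ hy
  have hdz := P.d_mem_strand l _ _ hz
  rw [add_sub_cancel_right, sub_add_cancel] at hdz
  obtain ⟨w, hw, e2⟩ := exists_map_eq_of_map_eq_zero E.exact l _ _ (sub_mem hv hdz)
    (by rw [map_sub, map_d E.g_x, e', sub_self])
  refine ⟨w, by rwa [add_sub_cancel_right], map_injective E.injective l ?_⟩
  rw [map_d E.f_x, e2, map_sub, d_d P.comm, sub_zero, e]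

/-- Dimension shifting along a minimal presentation by an acyclic module. -/
theorem vanishes_succ_iff {l : List σ} (hP : ∀ i a, i ≠ 0 → P.Vanishes l i a)
    (hmin : ∀ a, ∀ n ∈ G'.deg a, E.f n ∈ P.boundary l a) {i : ℤ} (hi : 0 ≤ i) (a : ℤ) :
    G.Vanishes l (i + 1) a ↔ G'.Vanishes l i (a + 1) := by
  refine ⟨fun h => E.vanishes_of_succ h ?_, fun h => E.vanishes_succ h (hP _ _ (by omega))⟩
  intro n hn h0
  -- In degree zero F has homology, but minimality makes the map from H_0(N') to H_0(F) zero.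
  by_cases hi0 : i = 0
  · subst hi0
    obtain ⟨m, hm, rfl⟩ := (mem_strand_zero_iff _ l _).1 hn
    rw [map_incl]
    have := (exists_d_eq_incl_iff l (a + 1) (E.f m)).2 (hmin _ m hm)
    rwa [add_sub_cancel_right] at this
  · obtain ⟨w, hw, e⟩ := hP i (a + 1) hi0 _ (map_mem_strand (E.f_mem _) l _ hn)
      (by rw [← map_d E.f_x, h0, map_zero])
    exact ⟨w, by rwa [add_sub_cancel_right] at hw, e⟩

/-- By minimality N' dies in F modulo the operators, so N and F have the same quotient by them. -/
theorem vanishes_zero_iff {l : List σ} (hmin : ∀ a, ∀ n ∈ G'.deg a, E.f n ∈ P.boundary l a)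
    (a : ℤ) : G.Vanishes l 0 a ↔ P.Vanishes l 0 a := by
  rw [OperatorGrading.vanishes_zero_iff, OperatorGrading.vanishes_zero_iff]
  have key : ∀ n ∈ G.boundary l a, ∃ v ∈ P.boundary l a, v ∈ P.deg a ∧ E.g v = n := by
    intro n hn
    let B : AddSubgroup N := (P.boundary l a ⊓ P.deg a).map E.g
    have : G.boundary l a ≤ B := by
      refine iSup₂_le fun s hs => ?_
      rintro _ ⟨m, hm, rfl⟩
      obtain ⟨v, hv, rfl⟩ := E.surjOn _ m hm
      refine ⟨P.x s v, ⟨?_, ?_⟩, E.g_x s v⟩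
      · exact (le_iSup₂ (f := fun s (_ : s ∈ l) => (P.deg (a - 1)).map (P.x s)) s hs) ⟨v, hv, rfl⟩
      · have := P.x_mem s _ v hv
        rwa [sub_add_cancel] at this
    obtain ⟨v, hv, e⟩ := this hn
    exact ⟨v, hv.1, hv.2, e⟩
  constructor
  · intro h v hv
    obtain ⟨w, hw, hw', e⟩ := key _ (h (E.g_mem a v hv))
    obtain ⟨n, hn, e'⟩ := E.exact a (v - w) (sub_mem hv hw') (by rw [map_sub, e, sub_self])
    have := hmin a n hn
    rw [e'] at this
    simpa using add_mem this hw
  · intro h n hn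
    obtain ⟨v, hv, rfl⟩ := E.surjOn a n hn
    have h1 : P.boundary l a ≤ (G.boundary l a).comap E.g := by
      refine iSup₂_le fun s hs => ?_
      rintro _ ⟨m, hm, rfl⟩
      rw [AddSubgroup.mem_comap]
      rw [E.g_x]
      exact (le_iSup₂ (f := fun s (_ : s ∈ l) => (G.deg (a - 1)).map (G.x s)) s hs)
        ⟨_, E.g_mem _ m hm, rfl⟩
    exact h1 (h hv)

end ShortExact

end OperatorGrading

/-! ### Graded free modules over the polynomial ring -/

namespace GradedFree

variable {σ k ι κ : Type*} [Field k]

/-- The elements of degree `c` of the free module with basis vectors of degrees `deg`. -/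
def freeDeg (deg : ι → ℕ) (c : ℤ) : AddSubgroup (ι → MvPolynomial σ k) where
  carrier := {v | ∀ l m, coeff m (v l) ≠ 0 → (m.degree : ℤ) + deg l = c}
  zero_mem' := fun l m h => absurd (coeff_zero m) h
  add_mem' := fun {v w} hv hw l m h => by
    by_cases h0 : coeff m (v l) = 0
    · exact hw l m fun h1 => h (by simp [h0, h1])
    · exact hv l m h0
  neg_mem' := fun {v} hv l m h => hv l m fun h0 => h (by simp [h0])

theorem monomial_smul_mem_freeDeg {deg : ι → ℕ} {c : ℤ} {v : ι → MvPolynomial σ k}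
    (hv : v ∈ freeDeg deg c) (m : σ →₀ ℕ) (r : k) :
    monomial m r • v ∈ freeDeg deg (c + m.degree) := by
  classical
  intro l m' h
  rw [Pi.smul_apply, smul_eq_mul, coeff_monomial_mul'] at h
  split_ifs at h with hm
  · have := hv l _ (right_ne_zero_of_mul h)
    rw [← this]
    conv_lhs => rw [← tsub_add_cancel_of_le hm]
    rw [map_add]; push_cast; ring
  · exact absurd rfl h

theorem single_one_mem_freeDeg [DecidableEq ι] (deg : ι → ℕ) (j : ι) :
    (Pi.single j 1 : ι → MvPolynomial σ k) ∈ freeDeg deg (deg j) := by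
  classical
  intro l m h
  by_cases hl : l = j
  · subst hl
    rw [Pi.single_eq_same, coeff_one] at h
    split_ifs at h with hm
    · subst hm; simp
    · exact absurd rfl h
  · rw [Pi.single_eq_of_ne hl] at h; exact absurd (coeff_zero m) h

theorem single_monomial_mem_freeDeg [DecidableEq ι] (deg : ι → ℕ) (j : ι) (m : σ →₀ ℕ) (r : k) :
    (Pi.single j (monomial m r) : ι → MvPolynomial σ k) ∈ freeDeg deg (m.degree + deg j) := by
  have := monomial_smul_mem_freeDeg (single_one_mem_freeDeg (σ := σ) (k := k) deg j) m r
  rwa [← Pi.single_smul, smul_eq_mul, mul_one, add_comm] at this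

/-- A module over the polynomial ring, graded so that the variables have degree one. -/
noncomputable def moduleGrading {N : Type*} [AddCommGroup N] [Module (MvPolynomial σ k) N]
    (D : ℤ → AddSubgroup N) (h : ∀ (s : σ) a, ∀ n ∈ D a, (X s : MvPolynomial σ k) • n ∈ D (a + 1)) :
    OperatorGrading σ N where
  x s := DistribSMul.toAddMonoidHom N (X s : MvPolynomial σ k)
  deg := D
  comm s t n := smul_comm (X s : MvPolynomial σ k) (X t : MvPolynomial σ k) n
  x_mem := h

theorem X_smul_mem_freeDeg {deg : ι → ℕ} (s : σ) (a : ℤ) (v : ι → MvPolynomial σ k)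
    (hv : v ∈ freeDeg deg a) : (X s : MvPolynomial σ k) • v ∈ freeDeg deg (a + 1) := by
  have := monomial_smul_mem_freeDeg hv (Finsupp.single s 1) 1
  rwa [Finsupp.degree_single, Nat.cast_one] at this

variable (σ k) in
/-- The graded free module with basis vectors of degrees `deg`. -/
noncomputable def freeGrading (deg : ι → ℕ) : OperatorGrading σ (ι → MvPolynomial σ k) :=
  moduleGrading (freeDeg deg) X_smul_mem_freeDeg

/-- The induced grading of a submodule of a graded free module. -/
noncomputable def subGrading (deg : ι → ℕ)
    (P : Submodule (MvPolynomial σ k) (ι → MvPolynomial σ k)) : OperatorGrading σ P :=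
  moduleGrading (fun a => (freeDeg deg a).comap P.subtype.toAddMonoidHom)
    fun s a n hn => by
      rw [AddSubgroup.mem_comap, LinearMap.toAddMonoidHom_coe, map_smul]
      exact X_smul_mem_freeDeg s a _ hn

/-- The variables in `l` generate a monomial ideal, so membership is tested on coefficients.
Conversely, division by each variable with remainder splits off its multiples and keeps the quotient
homogeneous. -/
theorem mem_boundary_iff {deg : ι → ℕ} (l : List σ) {a : ℤ} {v : ι → MvPolynomial σ k}
    (hv : v ∈ freeDeg deg a) : v ∈ (freeGrading σ k deg).boundary l a ↔
      ∀ j m, (∀ s ∈ l, m s = 0) → coeff m (v j) = 0 := by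
  classical
  constructor
  · intro h j m hm
    let B : AddSubgroup (ι → MvPolynomial σ k) :=
      { carrier := {v | coeff m (v j) = 0}
        zero_mem' := coeff_zero m
        add_mem' := fun {v w} (hv : coeff m (v j) = 0) (hw : coeff m (w j) = 0) =>
          show coeff m (v j + w j) = 0 by rw [coeff_add, hv, hw, add_zero]
        neg_mem' := fun {v} (hv : coeff m (v j) = 0) =>
          show coeff m (-v j) = 0 by rw [coeff_neg, hv, neg_zero] }
    have : (freeGrading σ k deg).boundary l a ≤ B := by
      refine iSup₂_le fun s hs => ?_
      rintro _ ⟨w, -, rfl⟩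
      change coeff m (X s * w j) = 0
      rw [coeff_X_mul', if_neg]
      simp [hm s hs]
    exact this h
  · intro h
    induction l generalizing v with
    | nil =>
      rw [OperatorGrading.boundary_nil, AddSubgroup.mem_bot]
      ext j m
      simpa using h j m (by simp)
    | cons s l ih =>
      rw [OperatorGrading.boundary_cons]
      let r : ι → MvPolynomial σ k := fun j => (v j).modMonomial (Finsupp.single s 1)
      let q : ι → MvPolynomial σ k := fun j => (v j).divMonomial (Finsupp.single s 1)
      have hvr : v = r + (X s : MvPolynomial σ k) • q := by
        ext1 j
        exact (modMonomial_add_divMonomial_single (v j) s).symm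
      have hr : ∀ j m, coeff m (r j) ≠ 0 → m s = 0 ∧ coeff m (v j) ≠ 0 := by
        intro j m hm
        have hle : ¬ Finsupp.single s 1 ≤ m := fun h' => hm (coeff_modMonomial_of_le _ h')
        refine ⟨?_, ?_⟩
        · by_contra h0
          exact hle (Finsupp.single_le_iff.2 (Nat.one_le_iff_ne_zero.2 h0))
        · have h2 : coeff m (r j) = coeff m (v j) := coeff_modMonomial_of_not_le _ hle
          rwa [h2] at hm
      have hq : q ∈ freeDeg deg (a - 1) := by
        intro j m hm
        have h2 : coeff m (q j) = coeff (Finsupp.single s 1 + m) (v j) := coeff_divMonomial _ _ _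
        rw [h2] at hm
        have := hv j _ hm
        rw [map_add, Finsupp.degree_single] at this
        push_cast at this
        linarith
      rw [hvr]
      refine AddSubgroup.add_mem_sup (ih (fun j m hm => hv j m (hr j m hm).2) ?_) ⟨q, hq, rfl⟩
      intro j m hm
      by_contra h0
      refine (hr j m h0).2 (h j m fun t ht => ?_)
      rcases List.mem_cons.1 ht with rfl | ht
      · exact (hr j m h0).1
      · exact hm t ht

/-- The variables form a regular sequence: multiplication by a variable outside `l` does not change
whether a monomial involves a variable in `l`. -/
theorem free_acyclic (deg : ι → ℕ) {l : List σ} (hl : l.Nodup) :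
    ∀ i a, i ≠ 0 → (freeGrading σ k deg).Vanishes l i a := by
  classical
  induction l with
  | nil => exact OperatorGrading.acyclic_nil
  | cons s l ih =>
    rw [List.nodup_cons] at hl
    refine OperatorGrading.acyclic_cons (ih hl.2) fun a v hv h => ?_
    rw [mem_boundary_iff l ((freeGrading σ k deg).x_mem s a v hv)] at h
    refine (mem_boundary_iff l hv).2 fun j m hm => ?_
    have := h j (Finsupp.single s 1 + m) fun t ht => by
      have : s ≠ t := fun e => hl.1 (e ▸ ht)
      simp [hm t ht, this]
    change coeff _ (X s * v j) = 0 at this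
    rwa [coeff_X_mul] at this

/-- Modulo all the variables, only the span over k of the basis vectors remains. -/
theorem free_vanishes_zero_iff (deg : ι → ℕ) {l : List σ} (hl : ∀ s, s ∈ l) (a : ℤ) :
    (freeGrading σ k deg).Vanishes l 0 a ↔ ∀ j, (deg j : ℤ) ≠ a := by
  classical
  rw [OperatorGrading.vanishes_zero_iff]
  constructor
  · rintro h j rfl
    have := (mem_boundary_iff l (single_one_mem_freeDeg deg j)).1
      (h (single_one_mem_freeDeg deg j)) j 0 (by simp)
    simp at this
  · intro h v hv
    refine (mem_boundary_iff l hv).2 fun j m hm => ?_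
    by_contra h0
    have hm0 : m = 0 := Finsupp.ext fun s => hm s (hl s)
    refine h j ?_
    have := hv j m h0
    rw [hm0] at this
    simpa using this

theorem mem_boundary_of_constantCoeff {deg : ι → ℕ} {l : List σ} (hl : ∀ s, s ∈ l) {a : ℤ}
    {v : ι → MvPolynomial σ k} (hv : v ∈ freeDeg deg a) (h : ∀ j, constantCoeff (v j) = 0) :
    v ∈ (freeGrading σ k deg).boundary l a := by
  refine (mem_boundary_iff l hv).2 fun j m hm => ?_
  have hm0 : m = 0 := Finsupp.ext fun s => hm s (hl s)
  rw [hm0]; exact h j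

/-- The projection to the elements of degree `c`. -/
noncomputable def component (deg : ι → ℕ) (c : ℤ) :
    (ι → MvPolynomial σ k) →+ (ι → MvPolynomial σ k) :=
  -- Without the guard, `toNat` would turn a negative difference into 0 and select the constant
  -- term.
  AddMonoidHom.mk' (fun v l => if (deg l : ℤ) ≤ c then
    homogeneousComponent (c - deg l).toNat (v l) else 0) fun v w => by
      ext1 l
      by_cases h : (deg l : ℤ) ≤ c <;> simp [h]

theorem coeff_component (deg : ι → ℕ) (c : ℤ) (v : ι → MvPolynomial σ k) (l : ι) (m : σ →₀ ℕ) :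
    coeff m (component deg c v l) = if (m.degree : ℤ) + deg l = c then coeff m (v l) else 0 := by
  simp only [component, AddMonoidHom.mk'_apply]
  split_ifs with h1 h2 h2
  · rw [coeff_homogeneousComponent, if_pos (by omega)]
  · rw [coeff_homogeneousComponent, if_neg (by omega)]
  · omega
  · exact coeff_zero m

theorem component_mem (deg : ι → ℕ) (c : ℤ) (v : ι → MvPolynomial σ k) :
    component deg c v ∈ freeDeg deg c := by
  intro l m h
  rw [coeff_component] at h
  by_contra h'
  exact h (if_neg h')

theorem component_of_mem {deg : ι → ℕ} {c : ℤ} {v : ι → MvPolynomial σ k}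
    (hv : v ∈ freeDeg deg c) : component deg c v = v := by
  ext l m
  rw [coeff_component]
  split_ifs with h
  · rfl
  · by_contra h'
    exact h (hv l m (Ne.symm h'))

theorem component_of_mem_of_ne {deg : ι → ℕ} {c c' : ℤ} {v : ι → MvPolynomial σ k}
    (hv : v ∈ freeDeg deg c) (hc : c' ≠ c) : component deg c' v = 0 := by
  ext l m
  rw [coeff_component]
  split_ifs with h
  · by_contra h'
    exact hc (h ▸ hv l m h')
  · exact (coeff_zero m).symm

section Fintype

variable [Fintype ι] [DecidableEq ι]

theorem eq_sum_single_monomial (v : ι → MvPolynomial σ k) :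
    v = ∑ l, ∑ m ∈ (v l).support, Pi.single l (monomial m (coeff m (v l))) := by
  conv_lhs => rw [← Finset.univ_sum_single v]
  refine Finset.sum_congr rfl fun l _ => ?_
  conv_lhs => rw [← support_sum_monomial_coeff (v l)]
  exact map_sum (AddMonoidHom.single (fun _ : ι => MvPolynomial σ k) l) _ _

/-- A homomorphism that preserves the degrees of the terms is homogeneous. -/
theorem map_mem_of_single {N : Type*} [AddCommGroup N] {deg : ι → ℕ} {D : ℤ → AddSubgroup N}
    {f : (ι → MvPolynomial σ k) →+ N}
    (h : ∀ l m r, f (Pi.single l (monomial m r)) ∈ D (m.degree + deg l)) {c : ℤ}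
    {v : ι → MvPolynomial σ k} (hv : v ∈ freeDeg deg c) : f v ∈ D c := by
  rw [eq_sum_single_monomial v]
  simp only [map_sum]
  refine sum_mem fun l _ => sum_mem fun m hm => ?_
  rw [← hv l m (mem_support_iff.1 hm)]
  exact h _ _ _

/-- A homogeneous homomorphism commutes with the projections to the graded pieces. -/
theorem map_component {N : Type*} [AddCommGroup N] {deg : ι → ℕ}
    {f : (ι → MvPolynomial σ k) →+ N} {p : ℤ → N →+ N}
    (h : ∀ c, ∀ v ∈ freeDeg deg c, p c (f v) = f v)
    (h' : ∀ c c', ∀ v ∈ freeDeg deg c, c' ≠ c → p c' (f v) = 0)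
    (c : ℤ) (v : ι → MvPolynomial σ k) : f (component deg c v) = p c (f v) := by
  rw [eq_sum_single_monomial v]
  simp only [map_sum]
  refine Finset.sum_congr rfl fun l _ => Finset.sum_congr rfl fun m _ => ?_
  have hm := single_monomial_mem_freeDeg deg l m (coeff m (v l))
  by_cases hc : c = m.degree + deg l
  · rw [hc, component_of_mem hm, h _ _ hm]
  · rw [component_of_mem_of_ne hm hc, map_zero, h' _ _ _ hm hc]

theorem linear_map_mem {deg : ι → ℕ} {deg' : κ → ℕ}
    {f : (ι → MvPolynomial σ k) →ₗ[MvPolynomial σ k] (κ → MvPolynomial σ k)}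
    (h : ∀ j, f (Pi.single j 1) ∈ freeDeg deg' (deg j)) {c : ℤ} {v : ι → MvPolynomial σ k}
    (hv : v ∈ freeDeg deg c) : f v ∈ freeDeg deg' c := by
  refine map_mem_of_single (f := f.toAddMonoidHom) (fun l m r => ?_) hv
  have : (Pi.single l (monomial m r) : ι → MvPolynomial σ k) = monomial m r • Pi.single l 1 := by
    rw [← Pi.single_smul, smul_eq_mul, mul_one]
  rw [this, add_comm]
  change f _ ∈ _
  rw [map_smul]
  exact monomial_smul_mem_freeDeg (h l) m r

theorem linear_map_component {deg : ι → ℕ} {deg' : κ → ℕ}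
    {f : (ι → MvPolynomial σ k) →ₗ[MvPolynomial σ k] (κ → MvPolynomial σ k)}
    (h : ∀ j, f (Pi.single j 1) ∈ freeDeg deg' (deg j)) (c : ℤ) (v : ι → MvPolynomial σ k) :
    f (component deg c v) = component deg' c (f v) :=
  map_component (f := f.toAddMonoidHom) (p := component deg')
    (fun _ _ hv => component_of_mem (linear_map_mem h hv))
    (fun _ _ _ hv hc => component_of_mem_of_ne (linear_map_mem h hv) hc) c v

end Fintype

theorem mem_freeDeg_iff_isHomogeneous {deg : ι → ℕ} {c : ℕ} {v : ι → MvPolynomial σ k} :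
    v ∈ freeDeg deg c ↔ ∀ l, v l = 0 ∨ ∃ n, deg l + n = c ∧ (v l).IsHomogeneous n := by
  constructor
  · intro h l
    by_cases h0 : v l = 0
    · exact Or.inl h0
    · obtain ⟨m, hm⟩ := exists_coeff_ne_zero h0
      refine Or.inr ⟨m.degree, by have := h l m hm; omega, fun m' hm' => ?_⟩
      have h1 := h l m hm
      have h2 := h l m' hm'
      have h3 : Finsupp.degree m' = m.degree := by omega
      rw [← h3, Finsupp.degree_eq_weight_one]; rfl
  · intro h l m hm
    rcases h l with h0 | ⟨n, hn, hh⟩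
    · rw [h0] at hm; exact absurd (coeff_zero m) hm
    · have : m.degree = n := by
        by_contra h'
        exact hm (hh.coeff_eq_zero h')
      omega

end GradedFree

/-! ### Degrees in a minimal resolution via Koszul homology -/

namespace GradedFree

variable {σ k R : Type*} [Field k] [CommRing R] [Algebra k R]

/-- A presentation of a graded algebra by a standard graded polynomial ring. -/
structure GradedPresentation (φ : MvPolynomial σ k →ₐ[k] R) (𝒜 : ℕ → Submodule k R) where
  proj : ℕ → R →+ R
  proj_of_mem : ∀ n, ∀ r ∈ 𝒜 n, proj n r = r
  proj_of_mem_of_ne : ∀ n n', ∀ r ∈ 𝒜 n, n' ≠ n → proj n' r = 0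
  monomial_mul_mem : ∀ n, ∀ r ∈ 𝒜 n, ∀ m c, φ (monomial m c) * r ∈ 𝒜 (m.degree + n)
  one_mem : 1 ∈ 𝒜 0
  surjective : Function.Surjective φ

/-- The graded pieces, indexed by the integers. -/
def ringDeg (𝒜 : ℕ → Submodule k R) (c : ℤ) : AddSubgroup R :=
  if 0 ≤ c then (𝒜 c.toNat).toAddSubgroup else ⊥

theorem mem_ringDeg_natCast {𝒜 : ℕ → Submodule k R} {n : ℕ} {r : R} :
    r ∈ ringDeg 𝒜 n ↔ r ∈ 𝒜 n := by
  rw [ringDeg, if_pos (by omega)]; simp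

theorem mem_ringDeg_iff {𝒜 : ℕ → Submodule k R} {c : ℤ} {r : R} :
    r ∈ ringDeg 𝒜 c ↔ r = 0 ∨ ∃ n : ℕ, (n : ℤ) = c ∧ r ∈ 𝒜 n := by
  by_cases h : 0 ≤ c
  · lift c to ℕ using h
    rw [mem_ringDeg_natCast]
    constructor
    · exact fun h => Or.inr ⟨c, rfl, h⟩
    · rintro (rfl | ⟨n, hn, h⟩)
      · exact zero_mem _
      · rwa [Nat.cast_injective hn] at h
  · rw [ringDeg, if_neg h, AddSubgroup.mem_bot]
    constructor
    · exact Or.inl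
    · rintro (h' | ⟨n, hn, -⟩)
      · exact h'
      · omega

namespace GradedPresentation

variable {φ : MvPolynomial σ k →ₐ[k] R} {𝒜 : ℕ → Submodule k R} (H : GradedPresentation φ 𝒜)

/-- The projections to the graded pieces, indexed by the integers. -/
def projInt (c : ℤ) : R →+ R := if 0 ≤ c then H.proj c.toNat else 0

theorem projInt_of_mem {c : ℤ} {r : R} (hr : r ∈ ringDeg 𝒜 c) : H.projInt c r = r := by
  rcases mem_ringDeg_iff.1 hr with rfl | ⟨n, rfl, h⟩
  · exact map_zero _
  · rw [projInt, if_pos (by omega)]; exact H.proj_of_mem n r h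

theorem projInt_of_mem_of_ne {c c' : ℤ} {r : R} (hr : r ∈ ringDeg 𝒜 c) (hc : c' ≠ c) :
    H.projInt c' r = 0 := by
  rcases mem_ringDeg_iff.1 hr with rfl | ⟨n, rfl, h⟩
  · exact map_zero _
  · rw [projInt]
    split_ifs with h0
    · exact H.proj_of_mem_of_ne n _ r h (by omega)
    · rfl

/-- The graded algebra with the operators given by the variables. -/
noncomputable def grading : OperatorGrading σ R where
  x s := AddMonoidHom.mulLeft (φ (X s))
  deg := ringDeg 𝒜
  comm s t n := mul_left_comm _ _ _
  x_mem s a n hn := by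
    rcases mem_ringDeg_iff.1 hn with rfl | ⟨m, rfl, h⟩
    · rw [map_zero]; exact zero_mem _
    · refine mem_ringDeg_iff.2 (Or.inr ⟨m + 1, by push_cast; rfl, ?_⟩)
      have := H.monomial_mul_mem m n h (Finsupp.single s 1) 1
      rwa [Finsupp.degree_single, add_comm] at this

end GradedPresentation

/-- A minimal graded free resolution without a bound on its length. -/
structure MinimalGradedFreeChain (φ : MvPolynomial σ k →ₐ[k] R) (𝒜 : ℕ → Submodule k R) where
  rank : ℕ → ℕ
  deg : (i : ℕ) → Fin (rank i) → ℕ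
  diff : (i : ℕ) →
    (Fin (rank (i + 1)) → MvPolynomial σ k) →ₗ[MvPolynomial σ k] (Fin (rank i) → MvPolynomial σ k)
  aug : (Fin (rank 0) → MvPolynomial σ k) →ₛₗ[(φ : MvPolynomial σ k →+* R)] R
  aug_homogeneous : ∀ j, aug (Pi.single j 1) ∈ 𝒜 (deg 0 j)
  diff_homogeneous : ∀ i j, diff i (Pi.single j 1) ∈ freeDeg (deg i) (deg (i + 1) j)
  aug_surjective : Function.Surjective aug
  exact_zero : LinearMap.ker aug = LinearMap.range (diff 0)
  exact_succ : ∀ i, LinearMap.ker (diff i) = LinearMap.range (diff (i + 1))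
  minimal : ∀ i j l, constantCoeff (diff i (Pi.single j 1) l) = 0

/-- Forget that a resolution is finite. -/
def _root_.MinimalGradedFreeResolution.toChain {φ : MvPolynomial σ k →ₐ[k] R}
    {𝒜 : ℕ → Submodule k R} (F : MinimalGradedFreeResolution φ 𝒜) :
    MinimalGradedFreeChain φ 𝒜 where
  rank := F.rank
  deg := F.deg
  diff := F.diff
  aug := F.aug
  aug_homogeneous := F.aug_homogeneous
  diff_homogeneous i j := mem_freeDeg_iff_isHomogeneous.2 (F.diff_homogeneous i j)
  aug_surjective := F.aug_surjective
  exact_zero := F.exact_zero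
  exact_succ := F.exact_succ
  minimal := F.minimal

namespace MinimalGradedFreeChain

variable {φ : MvPolynomial σ k →ₐ[k] R} {𝒜 : ℕ → Submodule k R} (C : MinimalGradedFreeChain φ 𝒜)
  (H : GradedPresentation φ 𝒜)

theorem constantCoeff_diff (i : ℕ) (v : Fin (C.rank (i + 1)) → MvPolynomial σ k)
    (l : Fin (C.rank i)) : constantCoeff (C.diff i v l) = 0 := by
  have : v = ∑ j, v j • (Pi.single j 1 : Fin (C.rank (i + 1)) → MvPolynomial σ k) := by
    conv_lhs => rw [← Finset.univ_sum_single v]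
    exact Finset.sum_congr rfl fun j _ => by rw [← Pi.single_smul, smul_eq_mul, mul_one]
  rw [this, map_sum, Finset.sum_apply, map_sum]
  exact Finset.sum_eq_zero fun j _ => by simp [C.minimal]

/-- The modules of syzygies with their gradings. -/
noncomputable def syzygyGrading (i : ℕ) : OperatorGrading σ (LinearMap.range (C.diff i)) :=
  subGrading (C.deg i) (LinearMap.range (C.diff i))

include H in
theorem aug_mem {c : ℤ} {v : Fin (C.rank 0) → MvPolynomial σ k} (hv : v ∈ freeDeg (C.deg 0) c) :
    C.aug v ∈ ringDeg 𝒜 c := by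
  refine map_mem_of_single (f := C.aug.toAddMonoidHom) (fun l m r => ?_) hv
  have : (Pi.single l (monomial m r) : Fin (C.rank 0) → MvPolynomial σ k) =
      monomial m r • Pi.single l 1 := by
    rw [← Pi.single_smul, smul_eq_mul, mul_one]
  rw [this]
  change C.aug _ ∈ _
  rw [map_smulₛₗ]
  refine mem_ringDeg_iff.2 (Or.inr ⟨_, rfl, ?_⟩)
  exact H.monomial_mul_mem _ _ (C.aug_homogeneous l) m r

theorem aug_component (c : ℤ) (v : Fin (C.rank 0) → MvPolynomial σ k) :
    C.aug (component (C.deg 0) c v) = H.projInt c (C.aug v) :=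
  map_component (f := C.aug.toAddMonoidHom) (p := H.projInt)
    (fun _ _ hv => H.projInt_of_mem (C.aug_mem H hv))
    (fun _ _ _ hv hc => H.projInt_of_mem_of_ne (C.aug_mem H hv) hc) c v

/-- The exact sequence of the first syzygies. -/
noncomputable def shortExactZero :
    OperatorGrading.ShortExact (C.syzygyGrading 0) (freeGrading σ k (C.deg 0)) H.grading where
  f := (LinearMap.range (C.diff 0)).subtype.toAddMonoidHom
  g := C.aug.toAddMonoidHom
  f_x _ _ := rfl
  g_x s n := C.aug.map_smulₛₗ (X s) n
  f_mem _ _ h := h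
  g_mem _ _ h := C.aug_mem H h
  injective := Subtype.val_injective
  comp n := C.exact_zero.ge n.2
  exact a v hv h := by
    have : v ∈ LinearMap.range (C.diff 0) := by rw [← C.exact_zero]; exact h
    exact ⟨⟨v, this⟩, hv, rfl⟩
  -- Any preimage becomes homogeneous after passing to its component of degree a.
  surjOn a r hr := by
    obtain ⟨v, rfl⟩ := C.aug_surjective r
    exact ⟨component (C.deg 0) a v, component_mem _ _ _,
      (C.aug_component H a v).trans (H.projInt_of_mem hr)⟩

/-- The exact sequences of the higher syzygies. -/
noncomputable def shortExactSucc (i : ℕ) :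
    OperatorGrading.ShortExact (C.syzygyGrading (i + 1)) (freeGrading σ k (C.deg (i + 1)))
      (C.syzygyGrading i) where
  f := (LinearMap.range (C.diff (i + 1))).subtype.toAddMonoidHom
  g := (C.diff i).rangeRestrict.toAddMonoidHom
  f_x _ _ := rfl
  g_x s n := (C.diff i).rangeRestrict.map_smul (X s) n
  f_mem _ _ h := h
  g_mem _ _ h := linear_map_mem (C.diff_homogeneous i) h
  injective := Subtype.val_injective
  comp n := Subtype.ext ((C.exact_succ i).ge n.2)
  exact a v hv h := by
    have : v ∈ LinearMap.range (C.diff (i + 1)) := by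
      rw [← C.exact_succ]; exact congrArg Subtype.val h
    exact ⟨⟨v, this⟩, hv, rfl⟩
  surjOn a r hr := by
    obtain ⟨_, v, rfl⟩ := r
    exact ⟨component (C.deg (i + 1)) a v, component_mem _ _ _, Subtype.ext
      ((linear_map_component (C.diff_homogeneous i) a v).trans (component_of_mem hr))⟩

theorem syzygy_mem_boundary {l : List σ} (hl : ∀ s, s ∈ l) (i : ℕ) (a : ℤ)
    (n : LinearMap.range (C.diff i)) (hn : n ∈ (C.syzygyGrading i).deg a) :
    (n : Fin (C.rank i) → MvPolynomial σ k) ∈ (freeGrading σ k (C.deg i)).boundary l a := by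
  obtain ⟨_, v, rfl⟩ := n
  exact mem_boundary_of_constantCoeff hl hn (C.constantCoeff_diff i v)

/-- Iterated dimension shifting: Tor_{j+i+1} of R is Tor_j of the i-th module in `syzygyGrading`,
with the internal degree unchanged. -/
theorem vanishes_syzygy_iff {l : List σ} (hl : ∀ s, s ∈ l) (hd : l.Nodup) (i : ℕ) {j : ℤ}
    (hj : 0 ≤ j) (a : ℤ) :
    H.grading.Vanishes l (j + (i + 1 : ℕ)) a ↔
      (C.syzygyGrading i).Vanishes l j (a + (i + 1 : ℕ)) := by
  induction i generalizing j with
  | zero =>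
    exact (C.shortExactZero H).vanishes_succ_iff (free_acyclic _ hd)
      (C.syzygy_mem_boundary hl 0) hj a
  | succ i ih =>
    have h1 := ih (j := j + 1) (by omega)
    have h2 := (C.shortExactSucc i).vanishes_succ_iff (free_acyclic _ hd)
      (C.syzygy_mem_boundary hl (i + 1)) hj (a + (i + 1 : ℕ))
    rw [h2] at h1
    convert h1 using 2 <;> push_cast <;> ring

/-- The degrees in a minimal resolution are those of the Koszul homology. -/
theorem exists_deg_eq_iff {l : List σ} (hl : ∀ s, s ∈ l) (hd : l.Nodup) (i : ℕ) (a : ℤ) :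
    (∃ j, (C.deg i j : ℤ) = a + i) ↔ ¬ H.grading.Vanishes l i a := by
  cases i with
  | zero =>
    rw [Nat.cast_zero, (C.shortExactZero H).vanishes_zero_iff (C.syzygy_mem_boundary hl 0),
      free_vanishes_zero_iff _ hl, add_zero]
    push Not; rfl
  | succ i =>
    have h := C.vanishes_syzygy_iff H hl hd i le_rfl a
    rw [zero_add] at h
    rw [h, (C.shortExactSucc i).vanishes_zero_iff (C.syzygy_mem_boundary hl (i + 1)),
      free_vanishes_zero_iff _ hl]
    push Not; rfl

include H in
-- Hilbert's syzygy theorem: a generator of F_i would give Koszul homology beyond the length of the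
-- complex.
theorem rank_eq_zero {l : List σ} (hl : ∀ s, s ∈ l) (hd : l.Nodup) (i : ℕ) (hi : l.length < i) :
    C.rank i = 0 := by
  by_contra h
  let j : Fin (C.rank i) := ⟨0, Nat.pos_of_ne_zero h⟩
  refine (C.exists_deg_eq_iff H hl hd i (C.deg i j - i)).1 ⟨j, by ring⟩ ?_
  exact OperatorGrading.vanishes_of_length_lt l (by exact_mod_cast hi) _

end MinimalGradedFreeChain

end GradedFree

/-! ### Existence of the minimal resolution and the regularity criterion -/

namespace GradedFree

variable {σ k R : Type*} [Field k] [CommRing R] [Algebra k R]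

/-- A graded submodule of a graded free module. -/
def IsGraded {ι : Type*} (deg : ι → ℕ)
    (P : Submodule (MvPolynomial σ k) (ι → MvPolynomial σ k)) : Prop :=
  ∀ v ∈ P, ∀ c, component deg c v ∈ P

theorem isGraded_ker {ι κ : Type*} [Fintype ι] [DecidableEq ι] {deg : ι → ℕ} {deg' : κ → ℕ}
    {f : (ι → MvPolynomial σ k) →ₗ[MvPolynomial σ k] (κ → MvPolynomial σ k)}
    (h : ∀ j, f (Pi.single j 1) ∈ freeDeg deg' (deg j)) : IsGraded deg (LinearMap.ker f) := by
  intro v hv c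
  rw [LinearMap.mem_ker] at hv ⊢
  rw [linear_map_component h, hv, map_zero]

section Generators

variable {ι : Type*} {deg : ι → ℕ}

/-- A finitely generated graded submodule is generated by finitely many homogeneous elements. -/
theorem exists_homogeneous_generators [Finite σ] [Fintype ι] [DecidableEq ι]
    {P : Submodule (MvPolynomial σ k) (ι → MvPolynomial σ k)} (hP : IsGraded deg P) :
    ∃ (n : ℕ) (e : Fin n → ℕ) (g : Fin n → ι → MvPolynomial σ k),
      (∀ j, g j ∈ freeDeg deg (e j)) ∧ Submodule.span (MvPolynomial σ k) (Set.range g) = P := by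
  let T : Set (ι → MvPolynomial σ k) := {v | v ∈ P ∧ ∃ c : ℕ, v ∈ freeDeg deg c}
  have hT : Submodule.span (MvPolynomial σ k) T = P := by
    refine le_antisymm (Submodule.span_le.2 fun v hv => hv.1) fun v hv => ?_
    have hz : ∀ c : ℤ, component deg c v ∈ Submodule.span (MvPolynomial σ k) T := by
      intro c
      by_cases hc : 0 ≤ c
      · lift c to ℕ using hc
        exact Submodule.subset_span ⟨hP v hv c, c, component_mem _ _ _⟩
      · have : component deg c v = 0 := by
          ext l m
          rw [coeff_component, if_neg (by omega)]; simp
        rw [this]; exact zero_mem _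
    let U : Finset ℤ := Finset.univ.biUnion fun l =>
      (v l).support.image fun m => (m.degree : ℤ) + deg l
    have hv' : v = ∑ c ∈ U, component deg c v := by
      ext l m
      rw [Finset.sum_apply, coeff_sum]
      simp only [coeff_component]
      rw [Finset.sum_ite_eq]
      split_ifs with h
      · rfl
      · by_contra h0
        exact h (Finset.mem_biUnion.2 ⟨l, Finset.mem_univ _,
          Finset.mem_image.2 ⟨m, mem_support_iff.2 h0, rfl⟩⟩)
    rw [hv']
    exact sum_mem fun c _ => hz c
  obtain ⟨s, hs, hs'⟩ := (Submodule.fg_span_iff_fg_span_finset_subset T).1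
    (IsNoetherian.noetherian (Submodule.span (MvPolynomial σ k) T))
  choose! e he using fun v (hv : v ∈ T) => hv.2
  refine ⟨s.card, fun j => e (s.equivFin.symm j), fun j => s.equivFin.symm j,
    fun j => he _ (hs (s.equivFin.symm j).2), ?_⟩
  rw [← hT, hs']
  congr 1
  ext v
  constructor
  · rintro ⟨j, rfl⟩; exact (s.equivFin.symm j).2
  · intro hv; exact ⟨s.equivFin ⟨v, hv⟩, by simp⟩

/-- The map from the free module given by a family of elements. -/
noncomputable def generatorMap {n : ℕ} (g : Fin n → ι → MvPolynomial σ k) :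
    (Fin n → MvPolynomial σ k) →ₗ[MvPolynomial σ k] (ι → MvPolynomial σ k) :=
  Fintype.linearCombination (MvPolynomial σ k) g

theorem generatorMap_single {n : ℕ} (g : Fin n → ι → MvPolynomial σ k) (j : Fin n) :
    generatorMap g (Pi.single j 1) = g j := by
  simp [generatorMap, Fintype.linearCombination_apply_single]

/-- A graded submodule has a homogeneous minimal presentation. -/
theorem exists_minimal_presentation [Finite σ] [Fintype ι] [DecidableEq ι]
    {P : Submodule (MvPolynomial σ k) (ι → MvPolynomial σ k)} (hP : IsGraded deg P) :
    ∃ (n : ℕ) (e : Fin n → ℕ)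
      (f : (Fin n → MvPolynomial σ k) →ₗ[MvPolynomial σ k] (ι → MvPolynomial σ k)),
      (∀ j, f (Pi.single j 1) ∈ freeDeg deg (e j)) ∧ LinearMap.range f = P ∧
      ∀ v ∈ LinearMap.ker f, ∀ j, constantCoeff (v j) = 0 := by
  classical
  have hex := exists_homogeneous_generators hP
  -- A homogeneous generating family of least size is minimal: a relation with a nonzero constant
  -- coefficient would make one generator redundant.
  obtain ⟨e, g, hg, hs⟩ := Nat.find_spec hex
  have hmin := fun m => Nat.find_min (m := m) hex
  generalize Nat.find hex = n at e g hg hs hmin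
  have hgen : ∀ j, generatorMap g (Pi.single j 1) ∈ freeDeg deg (e j) := fun j => by
    rw [generatorMap_single]; exact hg j
  refine ⟨n, e, generatorMap g, hgen, ?_, ?_⟩
  · rw [← hs, generatorMap, Fintype.range_linearCombination]
  · intro v hv j
    by_contra hc
    have hker := isGraded_ker hgen v hv (e j)
    -- In the part of degree e j of the relation, the j-th coefficient is exactly a nonzero scalar,
    -- so g j can be solved for.
    set w := component e (e j) v with hw
    have hwj : w j = C (constantCoeff (v j)) := by
      ext m
      rw [hw, coeff_component, coeff_C]
      by_cases hm : m = 0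
      · subst hm; simp [constantCoeff_eq]
      · have : ¬ ((m.degree : ℤ) + e j = e j) := by
          have : m.degree ≠ 0 := fun h => hm ((Finsupp.degree_eq_zero_iff m).1 h)
          omega
        rw [if_neg this, if_neg (Ne.symm hm)]
    obtain _ | n := n
    · exact j.elim0
    refine hmin n (Nat.lt_succ_self n) ⟨e ∘ j.succAbove, g ∘ j.succAbove, fun i => hg _, ?_⟩
    rw [← hs]
    refine le_antisymm (Submodule.span_mono (Set.range_comp_subset_range _ _)) ?_
    rw [Submodule.span_le]
    rintro _ ⟨i, rfl⟩
    by_cases hij : i = j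
    · subst hij
      rw [LinearMap.mem_ker, generatorMap, Fintype.linearCombination_apply,
        Fin.sum_univ_succAbove _ i, hwj] at hker
      have h1 : g i = (C (-(constantCoeff (v i))⁻¹) : MvPolynomial σ k) • ∑ t, w (i.succAbove t) • g (i.succAbove t) := by
        rw [eq_neg_of_add_eq_zero_right hker, smul_neg, smul_smul, ← C_mul, neg_mul,
          inv_mul_cancel₀ hc, map_neg, C_1, neg_smul, one_smul, neg_neg]
      rw [h1]
      exact Submodule.smul_mem _ _ (sum_mem fun t _ =>
        Submodule.smul_mem _ _ (Submodule.subset_span ⟨t, rfl⟩))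
    · obtain ⟨t, rfl⟩ := Fin.exists_succAbove_eq hij
      exact Submodule.subset_span ⟨t, rfl⟩

end Generators

variable (σ k) in
/-- A graded free module with a graded submodule. -/
structure Stage where
  rank : ℕ
  deg : Fin rank → ℕ
  sub : Submodule (MvPolynomial σ k) (Fin rank → MvPolynomial σ k)
  graded : IsGraded deg sub
  small : ∀ v ∈ sub, ∀ j, constantCoeff (v j) = 0

namespace Stage

variable [Finite σ]

/-- Minimality of a presentation is what `small` asks of its kernel, so the construction can be
repeated. -/
theorem exists_next (s : Stage σ k) : ∃ (t : Stage σ k)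
    (f : (Fin t.rank → MvPolynomial σ k) →ₗ[MvPolynomial σ k] (Fin s.rank → MvPolynomial σ k)),
    (∀ j, f (Pi.single j 1) ∈ freeDeg s.deg (t.deg j)) ∧ LinearMap.range f = s.sub ∧
      LinearMap.ker f = t.sub := by
  obtain ⟨n, e, f, hf, hr, hm⟩ := exists_minimal_presentation s.graded
  exact ⟨⟨n, e, LinearMap.ker f, isGraded_ker hf, hm⟩, f, hf, hr, rfl⟩

/-- The module of generators of the submodule, with the submodule of relations. -/
noncomputable def next (s : Stage σ k) : Stage σ k := s.exists_next.choose

/-- The presentation of the submodule. -/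
noncomputable def diff (s : Stage σ k) :
    (Fin s.next.rank → MvPolynomial σ k) →ₗ[MvPolynomial σ k] (Fin s.rank → MvPolynomial σ k) :=
  s.exists_next.choose_spec.choose

theorem diff_mem (s : Stage σ k) (j) : s.diff (Pi.single j 1) ∈ freeDeg s.deg (s.next.deg j) :=
  s.exists_next.choose_spec.choose_spec.1 j

theorem range_diff (s : Stage σ k) : LinearMap.range s.diff = s.sub :=
  s.exists_next.choose_spec.choose_spec.2.1

theorem ker_diff (s : Stage σ k) : LinearMap.ker s.diff = s.next.sub :=
  s.exists_next.choose_spec.choose_spec.2.2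

/-- The iterated syzygies. -/
noncomputable def iterate (s : Stage σ k) : ℕ → Stage σ k
  | 0 => s
  | i + 1 => (s.iterate i).next

end Stage

variable {φ : MvPolynomial σ k →ₐ[k] R} {𝒜 : ℕ → Submodule k R}

/-- The map `S ^ 1 → R` as a semilinear map. -/
noncomputable def augmentation (φ : MvPolynomial σ k →ₐ[k] R) :
    (Fin 1 → MvPolynomial σ k) →ₛₗ[(φ : MvPolynomial σ k →+* R)] R where
  toFun v := φ (v 0)
  map_add' _ _ := map_add φ _ _
  map_smul' _ _ := map_mul φ _ _

theorem augmentation_apply (v : Fin 1 → MvPolynomial σ k) : augmentation φ v = φ (v 0) := rfl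

namespace GradedPresentation

variable (H : GradedPresentation φ 𝒜)

include H in
theorem augmentation_mem {c : ℤ} {v : Fin 1 → MvPolynomial σ k}
    (hv : v ∈ freeDeg (fun _ => 0) c) : augmentation φ v ∈ ringDeg 𝒜 c := by
  refine map_mem_of_single (f := (augmentation φ).toAddMonoidHom) (fun l m r => ?_) hv
  have : φ (monomial m r) ∈ 𝒜 (m.degree + 0) := by
    simpa using H.monomial_mul_mem 0 1 H.one_mem m r
  obtain rfl := Subsingleton.elim l 0
  change φ (Pi.single (M := fun _ => MvPolynomial σ k) 0 (monomial m r) 0) ∈ _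
  rw [Pi.single_eq_same]
  exact mem_ringDeg_iff.2 (Or.inr ⟨m.degree, by simp, this⟩)

theorem augmentation_component (c : ℤ) (v : Fin 1 → MvPolynomial σ k) :
    augmentation φ (component (fun _ => 0) c v) = H.projInt c (augmentation φ v) :=
  map_component (f := (augmentation φ).toAddMonoidHom) (p := H.projInt)
    (fun _ _ hv => H.projInt_of_mem (H.augmentation_mem hv))
    (fun _ _ _ hv hc => H.projInt_of_mem_of_ne (H.augmentation_mem hv) hc) c v

/-- The stage given by the defining ideal of the algebra. -/
noncomputable def initialStage [Nontrivial R] : Stage σ k where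
  rank := 1
  deg _ := 0
  sub := LinearMap.ker (augmentation φ)
  graded v hv c := by
    rw [LinearMap.mem_ker] at hv ⊢
    rw [H.augmentation_component, hv, map_zero]
  small v hv j := by
    classical
    rw [LinearMap.mem_ker] at hv
    obtain rfl := Subsingleton.elim j 0
    -- The degree zero part of a relation is its constant term, and k embeds in R.
    have h := H.augmentation_component 0 v
    rw [hv, map_zero, augmentation_apply] at h
    have h0 : component (fun _ => 0) 0 v 0 = C (constantCoeff (v 0)) := by
      ext m
      rw [coeff_component, coeff_C]
      by_cases hm : m = 0
      · subst hm; simp [constantCoeff_eq]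
      · have : ¬ ((m.degree : ℤ) + (0 : ℕ) = 0) := by
          have : m.degree ≠ 0 := fun h => hm ((Finsupp.degree_eq_zero_iff m).1 h)
          omega
        rw [if_neg this, if_neg (Ne.symm hm)]
    rw [h0, ← algebraMap_eq, AlgHom.commutes] at h
    exact (map_eq_zero_iff _ (algebraMap k R).injective).1 h

/-- The minimal free resolution built from minimal generators. -/
noncomputable def chain [Finite σ] [Nontrivial R] : MinimalGradedFreeChain φ 𝒜 where
  rank i := (H.initialStage.iterate i).rank
  deg i := (H.initialStage.iterate i).deg
  diff i := (H.initialStage.iterate i).diff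
  aug := augmentation φ
  aug_homogeneous j := by
    obtain rfl := Subsingleton.elim (α := Fin 1) j 0
    change φ (Pi.single (M := fun _ => MvPolynomial σ k) (0 : Fin 1) 1 0) ∈ 𝒜 0
    rw [Pi.single_eq_same, map_one]
    exact H.one_mem
  diff_homogeneous i j := Stage.diff_mem _ j
  aug_surjective r := by
    obtain ⟨q, rfl⟩ := H.surjective r
    exact ⟨fun _ => q, rfl⟩
  exact_zero := (Stage.range_diff _).symm
  exact_succ i := (Stage.ker_diff _).trans (Stage.range_diff _).symm
  minimal i j l := (H.initialStage.iterate i).small _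
    ((Stage.range_diff _).le (LinearMap.mem_range_self _ _)) l

include H in
theorem nonempty_resolution [Finite σ] [Nontrivial R] {l : List σ} (hl : ∀ s, s ∈ l)
    (hd : l.Nodup) : Nonempty (MinimalGradedFreeResolution φ 𝒜) :=
  ⟨{ length := l.length
     rank := H.chain.rank
     deg := H.chain.deg
     diff := H.chain.diff
     aug := H.chain.aug
     rank_eq_zero := fun i hi => H.chain.rank_eq_zero H hl hd i hi
     aug_homogeneous := H.chain.aug_homogeneous
     diff_homogeneous := fun i j => mem_freeDeg_iff_isHomogeneous.1 (H.chain.diff_homogeneous i j)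
     aug_surjective := H.chain.aug_surjective
     exact_zero := H.chain.exact_zero
     exact_succ := H.chain.exact_succ
     minimal := H.chain.minimal }⟩

/-- The regularity is determined by the vanishing of the Koszul homology. -/
theorem isCastelnuovoMumfordRegularity [Finite σ] [Nontrivial R] {l : List σ}
    (hl : ∀ s, s ∈ l) (hd : l.Nodup) {r : ℤ} (h : ∀ i a, r < a → H.grading.Vanishes l i a)
    {i : ℕ} (hi : ¬ H.grading.Vanishes l i r) :
    IsCastelnuovoMumfordRegularity φ 𝒜 r := by
  refine ⟨H.nonempty_resolution hl hd, fun F => ⟨?_, ?_⟩⟩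
  · obtain ⟨j, hj⟩ := (F.toChain.exists_deg_eq_iff H hl hd i r).2 hi
    exact ⟨i, j, eq_sub_of_add_eq hj.symm⟩
  · rintro c ⟨i, j, rfl⟩
    by_contra hc
    exact (F.toChain.exists_deg_eq_iff H hl hd i (F.deg i j - i)).1
      ⟨j, (sub_add_cancel ((F.deg i j : ℤ)) (i : ℤ)).symm⟩ (h i _ (not_le.1 hc))

end GradedPresentation

end GradedFree

/-! ### The monomial basis of the ring -/

namespace MonomialCurve

/-- `u` is a sum of `n` elements of `M`. -/
def IsSum (M : Finset ℕ) : ℕ → ℕ → Prop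
  | 0, u => u = 0
  | n + 1, u => ∃ α ∈ M, ∃ v, u = α + v ∧ IsSum M n v

theorem IsSum.add {M : Finset ℕ} {n n' u u' : ℕ} (h : IsSum M n u) (h' : IsSum M n' u') :
    IsSum M (n + n') (u + u') := by
  induction n generalizing u with
  | zero =>
    obtain rfl : u = 0 := h
    rwa [zero_add, zero_add]
  | succ n ih =>
    obtain ⟨α, hα, v, rfl, hv⟩ := h
    rw [Nat.succ_add]
    exact ⟨α, hα, v + u', add_assoc _ _ _, ih hv⟩

theorem isSum_one {M : Finset ℕ} {α : ℕ} (h : α ∈ M) : IsSum M 1 α := ⟨α, h, 0, rfl, rfl⟩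

theorem IsSum.le {M : Finset ℕ} {d : ℕ} (hM : ∀ α ∈ M, α ≤ d) {n u : ℕ} (h : IsSum M n u) :
    u ≤ n * d := by
  induction n generalizing u with
  | zero => exact (show u = 0 from h).le.trans (Nat.zero_le _)
  | succ n ih =>
    obtain ⟨α, hα, v, rfl, hv⟩ := h
    have := ih hv
    have := hM α hα
    rw [Nat.succ_mul]; omega

/-- `m` is the exponent of a monomial of degree `n` of the monomial curve. -/
def IsExp (d : ℕ) (M : Finset ℕ) (n : ℕ) (m : Fin 2 →₀ ℕ) : Prop :=
  m 0 + m 1 = n * d ∧ IsSum M n (m 0)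

/-- The exponent of `x ^ α * y ^ (d - α)`. -/
noncomputable def expo (d α : ℕ) : Fin 2 →₀ ℕ := Finsupp.single 0 α + Finsupp.single 1 (d - α)

theorem expo_zero (d α : ℕ) : expo d α 0 = α := by simp [expo]

theorem expo_one (d α : ℕ) : expo d α 1 = d - α := by simp [expo]

theorem mon_eq_monomial (k : Type*) [Field k] (d α : ℕ) : mon k d α = monomial (expo d α) 1 := by
  rw [mon, expo, X_pow_eq_monomial, X_pow_eq_monomial, monomial_mul, one_mul]

theorem IsExp.add {d : ℕ} {M : Finset ℕ} {n n' : ℕ} {m m' : Fin 2 →₀ ℕ} (h : IsExp d M n m)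
    (h' : IsExp d M n' m') : IsExp d M (n + n') (m + m') := by
  refine ⟨?_, h.2.add h'.2⟩
  have := h.1
  have := h'.1
  rw [Finsupp.add_apply, Finsupp.add_apply, add_mul]; omega

theorem isExp_expo {d : ℕ} {M : Finset ℕ} (hM : ∀ α ∈ M, α ≤ d) {α : ℕ} (h : α ∈ M) :
    IsExp d M 1 (expo d α) := by
  have := hM α h
  refine ⟨?_, ?_⟩
  · rw [expo_zero, expo_one]; omega
  · rw [expo_zero]; exact isSum_one h

theorem isExp_zero_iff {d : ℕ} {M : Finset ℕ} {m : Fin 2 →₀ ℕ} : IsExp d M 0 m ↔ m = 0 := by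
  constructor
  · rintro ⟨h, -⟩
    ext i
    fin_cases i <;> simp <;> omega
  · rintro rfl
    exact ⟨by simp, rfl⟩

/-- The remaining sum v is at most nd, which leaves room to lower the exponent of y by d - α. -/
theorem IsExp.exists_of_isSum {d : ℕ} {M : Finset ℕ} (hM : ∀ α ∈ M, α ≤ d) {n : ℕ}
    {m : Fin 2 →₀ ℕ} (h : IsExp d M (n + 1) m) {α v : ℕ} (hα : α ∈ M) (hv : m 0 = α + v)
    (hs : IsSum M n v) : ∃ m', m = expo d α + m' ∧ IsExp d M n m' := by
  have h1 := h.1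
  have := hs.le hM
  have := hM α hα
  rw [Nat.succ_mul] at h1
  have hle : expo d α ≤ m := by
    intro i
    fin_cases i
    · simp [expo_zero]; omega
    · simp [expo_one]; omega
  refine ⟨m - expo d α, (add_tsub_cancel_of_le hle).symm, ?_, ?_⟩
  · rw [Finsupp.tsub_apply, Finsupp.tsub_apply, expo_zero, expo_one]; omega
  · rw [Finsupp.tsub_apply, expo_zero, hv, Nat.add_sub_cancel_left]; exact hs

theorem IsExp.exists_eq_add {d : ℕ} {M : Finset ℕ} (hM : ∀ α ∈ M, α ≤ d) {n : ℕ}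
    {m : Fin 2 →₀ ℕ} (h : IsExp d M (n + 1) m) :
    ∃ α ∈ M, ∃ m', m = expo d α + m' ∧ IsExp d M n m' := by
  obtain ⟨α, hα, v, hv, hs⟩ := h.2
  exact ⟨α, hα, h.exists_of_isSum hM hα hv hs⟩

section Ring

variable {k : Type*} [Field k] {d : ℕ} {M : Finset ℕ}

theorem mon_mem_ring {α : ℕ} (h : α ∈ M) : mon k d α ∈ ring k d M :=
  Algebra.subset_adjoin (Set.mem_image_of_mem _ h)

theorem monomial_mem_ring (hM : ∀ α ∈ M, α ≤ d) {n : ℕ} {m : Fin 2 →₀ ℕ} (h : IsExp d M n m)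
    (c : k) : monomial m c ∈ ring k d M := by
  induction n generalizing m with
  | zero =>
    rw [isExp_zero_iff.1 h]
    exact (ring k d M).algebraMap_mem c
  | succ n ih =>
    obtain ⟨α, hα, m', rfl, h'⟩ := h.exists_eq_add hM
    have := (ring k d M).mul_mem (mon_mem_ring hα) (ih h')
    rwa [mon_eq_monomial, monomial_mul, one_mul] at this

theorem isExp_of_mem_ring (hM : ∀ α ∈ M, α ≤ d) {f : MvPolynomial (Fin 2) k}
    (hf : f ∈ ring k d M) : ∀ m ∈ f.support, ∃ n, IsExp d M n m := by
  classical
  induction hf using Algebra.adjoin_induction with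
  | mem f h =>
    obtain ⟨α, hα, rfl⟩ := h
    intro m hm
    rw [mon_eq_monomial] at hm
    obtain rfl := Finset.mem_singleton.1 (support_monomial_subset hm)
    exact ⟨1, isExp_expo hM hα⟩
  | algebraMap c =>
    intro m hm
    obtain rfl := Finset.mem_singleton.1 (support_monomial_subset (s := 0) (a := c) hm)
    exact ⟨0, isExp_zero_iff.2 rfl⟩
  | add f g _ _ hf hg =>
    intro m hm
    rcases Finset.mem_union.1 (support_add hm) with h | h
    · exact hf m h
    · exact hg m h
  | mul f g _ _ hf hg =>
    intro m hm
    obtain ⟨m₁, h₁, m₂, h₂, rfl⟩ := Finset.mem_add.1 (support_mul f g hm)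
    obtain ⟨n₁, e₁⟩ := hf _ h₁
    obtain ⟨n₂, e₂⟩ := hg _ h₂
    exact ⟨_, e₁.add e₂⟩

theorem mem_ring_of_isExp (hM : ∀ α ∈ M, α ≤ d) {f : MvPolynomial (Fin 2) k}
    (h : ∀ m ∈ f.support, ∃ n, IsExp d M n m) : f ∈ ring k d M := by
  rw [← support_sum_monomial_coeff f]
  exact sum_mem fun m hm => monomial_mem_ring hM (h m hm).choose_spec _

theorem mem_piece_iff {n : ℕ} {f : ring k d M} :
    f ∈ piece k d M n ↔ (f : MvPolynomial (Fin 2) k).IsHomogeneous (n * d) := Iff.rfl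

theorem degree_fin_two (m : Fin 2 →₀ ℕ) : m.degree = m 0 + m 1 := by
  rw [Finsupp.degree_eq_sum]; simp

theorem isExp_of_mem_piece (hM : ∀ α ∈ M, α ≤ d) (hd : 0 < d) {n : ℕ} {f : ring k d M}
    (hf : f ∈ piece k d M n) {m : Fin 2 →₀ ℕ}
    (hm : m ∈ (f : MvPolynomial (Fin 2) k).support) : IsExp d M n m := by
  obtain ⟨n', h⟩ := isExp_of_mem_ring hM f.2 m hm
  have h1 : m.degree = n * d := by
    by_contra h'
    exact mem_support_iff.1 hm (IsHomogeneous.coeff_eq_zero hf h')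
  rw [degree_fin_two, h.1] at h1
  rwa [Nat.eq_of_mul_eq_mul_right hd h1] at h

theorem mem_piece_of_isExp {n : ℕ} {f : ring k d M}
    (h : ∀ m ∈ (f : MvPolynomial (Fin 2) k).support, IsExp d M n m) : f ∈ piece k d M n := by
  intro m hm
  have := (h m (mem_support_iff.2 hm)).1
  rw [← degree_fin_two] at this
  rw [← this, Finsupp.degree_eq_weight_one]; rfl

/-- The monomial with a given exponent as an element of the ring. -/
noncomputable def monomialElt (hM : ∀ α ∈ M, α ≤ d) {n : ℕ} {m : Fin 2 →₀ ℕ}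
    (h : IsExp d M n m) (c : k) : ring k d M := ⟨monomial m c, monomial_mem_ring hM h c⟩

theorem monomialElt_mem_piece (hM : ∀ α ∈ M, α ≤ d) {n : ℕ} {m : Fin 2 →₀ ℕ}
    (h : IsExp d M n m) (c : k) : monomialElt hM h c ∈ piece k d M n :=
  mem_piece_of_isExp fun m' hm' => by
    obtain rfl := Finset.mem_singleton.1 (support_monomial_subset hm')
    exact h

/-- An element is contained in each subgroup that contains its terms. -/
theorem mem_of_monomialElt_mem (hM : ∀ α ∈ M, α ≤ d) {B : AddSubgroup (ring k d M)}
    {f : ring k d M} {p : ℕ → Prop}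
    (hf : ∀ m ∈ (f : MvPolynomial (Fin 2) k).support, ∃ n, p n ∧ IsExp d M n m)
    (h : ∀ n, p n → ∀ m (hm : IsExp d M n m) c, monomialElt hM hm c ∈ B) : f ∈ B := by
  have key : f = ∑ m ∈ (f : MvPolynomial (Fin 2) k).support.attach,
      monomialElt hM (hf m m.2).choose_spec.2 (coeff m (f : MvPolynomial (Fin 2) k)) := by
    apply Subtype.ext
    rw [AddSubmonoidClass.coe_finsetSum]
    conv_lhs => rw [← support_sum_monomial_coeff (f : MvPolynomial (Fin 2) k)]
    exact (Finset.sum_attach _ fun m => monomial m (coeff m (f : MvPolynomial (Fin 2) k))).symm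
  rw [key]
  exact sum_mem fun m _ => h _ (hf m m.2).choose_spec.1 _ _ _

/-- A generator of the ring. -/
noncomputable def gen {α : ℕ} (h : α ∈ M) : ring k d M := ⟨mon k d α, mon_mem_ring h⟩

theorem presentation_X (α : {α // α ∈ M}) :
    presentation k d M (X α) = gen α.2 := by
  rw [presentation, aeval_X]; rfl

theorem isHomogeneous_mon (hM : ∀ α ∈ M, α ≤ d) {α : ℕ} (h : α ∈ M) :
    (mon k d α).IsHomogeneous d := by
  rw [mon_eq_monomial]
  refine isHomogeneous_monomial _ ?_
  have := hM α h
  rw [degree_fin_two, expo_zero, expo_one]; omega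

theorem presentation_coe (q : MvPolynomial {α // α ∈ M} k) :
    ((presentation k d M q : ring k d M) : MvPolynomial (Fin 2) k) =
      aeval (fun α : {α // α ∈ M} => mon k d α) q := by
  have : (ring k d M).val.comp (presentation k d M) =
      aeval (fun α : {α // α ∈ M} => mon k d α) := by
    ext1 α
    simp [presentation_X, gen]
  exact DFunLike.congr_fun this q

theorem presentation_mem_piece (hM : ∀ α ∈ M, α ≤ d) {n : ℕ}
    {q : MvPolynomial {α // α ∈ M} k} (hq : q.IsHomogeneous n) :
    presentation k d M q ∈ piece k d M n := by
  rw [mem_piece_iff, presentation_coe, mul_comm]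
  exact hq.aeval _ fun α => isHomogeneous_mon hM α.2

theorem presentation_surjective : Function.Surjective (presentation k d M) := by
  rintro ⟨f, hf⟩
  rw [ring, Set.image_eq_range] at hf
  obtain ⟨q, rfl⟩ := (Algebra.adjoin_range_eq_range_aeval k
    (fun α : {α // α ∈ M} => mon k d α)).le hf
  exact ⟨q, Subtype.ext (presentation_coe q)⟩

/-- The projection to the elements of degree `n`. -/
noncomputable def ringProj (hM : ∀ α ∈ M, α ≤ d) (n : ℕ) : ring k d M →+ ring k d M :=
  AddMonoidHom.mk' (fun f => ⟨homogeneousComponent (n * d) (f : MvPolynomial (Fin 2) k),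
    mem_ring_of_isExp hM fun m hm => isExp_of_mem_ring hM f.2 m (by
      rw [mem_support_iff, coeff_homogeneousComponent] at hm
      rw [mem_support_iff]
      exact fun h => hm (by rw [h, ite_self]))⟩) fun f g => Subtype.ext (map_add _ _ _)

/-- The presentation of the ring is graded. -/
noncomputable def gradedPresentation (hM : ∀ α ∈ M, α ≤ d) (hd : 0 < d) :
    GradedFree.GradedPresentation (presentation k d M) (piece k d M) where
  proj := ringProj hM
  proj_of_mem n r hr := Subtype.ext <| by
    change homogeneousComponent (n * d) (r : MvPolynomial (Fin 2) k) = r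
    exact (homogeneousComponent_of_mem (p := (r : MvPolynomial (Fin 2) k)) hr).trans (if_pos rfl)
  proj_of_mem_of_ne n n' r hr h := Subtype.ext <| by
    change homogeneousComponent (n' * d) (r : MvPolynomial (Fin 2) k) = 0
    exact (homogeneousComponent_of_mem (p := (r : MvPolynomial (Fin 2) k)) hr).trans
      (if_neg fun e => h (Nat.eq_of_mul_eq_mul_right hd e))
  monomial_mul_mem n r hr m c := by
    rw [mem_piece_iff, add_mul]
    exact (presentation_mem_piece hM (isHomogeneous_monomial c rfl)).mul hr
  one_mem := by
    rw [mem_piece_iff, zero_mul]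
    exact isHomogeneous_one _ _
  surjective := presentation_surjective

theorem coeff_gen_mul {α : ℕ} (h : α ∈ M) (f : ring k d M) (m : Fin 2 →₀ ℕ) :
    coeff m ((gen h * f : ring k d M) : MvPolynomial (Fin 2) k) =
      if expo d α ≤ m then coeff (m - expo d α) (f : MvPolynomial (Fin 2) k) else 0 := by
  change coeff m (mon k d α * (f : MvPolynomial (Fin 2) k)) = _
  rw [mon_eq_monomial, coeff_monomial_mul']
  simp

theorem coeff_add_gen_mul {α : ℕ} (h : α ∈ M) (f : ring k d M) (m : Fin 2 →₀ ℕ) :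
    coeff (expo d α + m) ((gen h * f : ring k d M) : MvPolynomial (Fin 2) k) =
      coeff m (f : MvPolynomial (Fin 2) k) := by
  change coeff _ (mon k d α * (f : MvPolynomial (Fin 2) k)) = _
  rw [mon_eq_monomial, coeff_monomial_mul, one_mul]

theorem gen_ne_zero {α : ℕ} (h : α ∈ M) : (gen h : ring k d M) ≠ 0 := by
  intro h0
  have : mon k d α = 0 := congrArg Subtype.val h0
  rw [mon_eq_monomial, monomial_eq_zero] at this
  exact one_ne_zero this

theorem gen_mul_monomialElt (hM : ∀ α ∈ M, α ≤ d) {n : ℕ} {α : ℕ} (h : α ∈ M)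
    {m : Fin 2 →₀ ℕ} (hm : IsExp d M n m) (hm' : IsExp d M (n + 1) (expo d α + m)) (c : k) :
    gen h * monomialElt hM hm c = monomialElt hM hm' c := by
  apply Subtype.ext
  change mon k d α * monomial m c = monomial _ c
  rw [mon_eq_monomial, monomial_mul, one_mul]

end Ring

end MonomialCurve

/-! ### Regularity from the top degree of R/Q -/

namespace MonomialCurve

/-- Combinatorial conditions on the exponents which say that the ring is Cohen–Macaulay, and that
`e` is the largest degree in which it is not generated by `x ^ d` and `y ^ d` over the lower
degrees. -/
structure HasTopDegree (d : ℕ) (M : Finset ℕ) (e : ℕ) : Prop where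
  pos : 0 < d
  le : ∀ α ∈ M, α ≤ d
  mem_zero : 0 ∈ M
  mem_d : d ∈ M
  -- On monomials: if x^d f is y^d times an element of R, then so is f.
  cancel : ∀ n u, IsSum M (n + 1) u → IsSum M (n + 1) (u + d) → IsSum M n u
  top : ∀ n u, e ≤ n → IsSum M (n + 1) u → IsSum M n u ∨ ∃ v, u = d + v ∧ IsSum M n v
  -- Quantifying over n with n + 1 = e avoids a truncated e - 1; for e = 0 the condition on n is
  -- vacuous.
  exists_not : ∃ u, IsSum M e u ∧ ∀ n, n + 1 = e →
    ¬ IsSum M n u ∧ ∀ v, u = d + v → ¬ IsSum M n v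

section

variable {k : Type*} [Field k] {d : ℕ} {M : Finset ℕ}

theorem IsExp.congr_degree {n n' : ℕ} {m : Fin 2 →₀ ℕ} (hd : 0 < d) (h : IsExp d M n m)
    (h' : IsExp d M n' m) : n = n' :=
  Nat.eq_of_mul_eq_mul_right hd (h.1.symm.trans h'.1)

/-- The term of a combination of `x ^ d` and `y ^ d` is a multiple of `x ^ d` or `y ^ d`. -/
theorem exists_of_coeff_ne_zero (hM : ∀ α ∈ M, α ≤ d) {α β : ℕ} (hα : α ∈ M) (hβ : β ∈ M)
    {f g : ring k d M} {m : Fin 2 →₀ ℕ}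
    (hm : coeff m ((gen hα * f + gen hβ * g : ring k d M) : MvPolynomial (Fin 2) k) ≠ 0) :
    ∃ n m', IsExp d M n m' ∧ (m = expo d α + m' ∨ m = expo d β + m') := by
  have aux : ∀ {γ : ℕ} (hγ : γ ∈ M) (f : ring k d M),
      coeff m ((gen hγ * f : ring k d M) : MvPolynomial (Fin 2) k) ≠ 0 →
      ∃ n m', IsExp d M n m' ∧ m = expo d γ + m' := by
    intro γ hγ f h
    rw [coeff_gen_mul] at h
    split_ifs at h with hle
    · obtain ⟨n, hn⟩ := isExp_of_mem_ring hM f.2 _ (mem_support_iff.2 h)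
      exact ⟨n, _, hn, (add_tsub_cancel_of_le hle).symm⟩
    · exact absurd rfl h
  by_cases h : coeff m ((gen hα * f : ring k d M) : MvPolynomial (Fin 2) k) = 0
  · have h' : coeff m ((gen hβ * g : ring k d M) : MvPolynomial (Fin 2) k) ≠ 0 := by
      intro h'
      apply hm
      change coeff m (((gen hα * f : ring k d M) : MvPolynomial (Fin 2) k) +
        ((gen hβ * g : ring k d M) : MvPolynomial (Fin 2) k)) = 0
      rw [coeff_add, h, h', add_zero]
    obtain ⟨n, m', h1, h2⟩ := aux hβ g h'
    exact ⟨n, m', h1, Or.inr h2⟩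
  · obtain ⟨n, m', h1, h2⟩ := aux hα f h
    exact ⟨n, m', h1, Or.inl h2⟩

theorem grading_x (hM : ∀ α ∈ M, α ≤ d) (hd : 0 < d) (α : {α // α ∈ M}) (f : ring k d M) :
    (gradedPresentation (k := k) hM hd).grading.x α f = gen α.2 * f := by
  change presentation k d M (X α) * f = _
  rw [presentation_X]

theorem mem_grading_deg (hM : ∀ α ∈ M, α ≤ d) (hd : 0 < d) {a : ℤ} {f : ring k d M} :
    f ∈ (gradedPresentation (k := k) hM hd).grading.deg a ↔
      f = 0 ∨ ∃ n : ℕ, (n : ℤ) = a ∧ f ∈ piece k d M n :=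
  GradedFree.mem_ringDeg_iff

end

namespace HasTopDegree

variable {d : ℕ} {M : Finset ℕ} {e : ℕ} (T : HasTopDegree d M e)

include T

theorem exists_isExp_of_le {n : ℕ} (hn : e ≤ n) {m : Fin 2 →₀ ℕ} (h : IsExp d M (n + 1) m) :
    ∃ α ∈ M, (α = 0 ∨ α = d) ∧ ∃ m', m = expo d α + m' ∧ IsExp d M n m' := by
  rcases T.top n _ hn h.2 with h1 | ⟨v, hv, h1⟩
  · exact ⟨0, T.mem_zero, Or.inl rfl, h.exists_of_isSum T.le T.mem_zero (zero_add _).symm h1⟩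
  · exact ⟨d, T.mem_d, Or.inr rfl, h.exists_of_isSum T.le T.mem_d hv h1⟩

theorem exists_isExp_not : ∃ m, IsExp d M e m ∧ ∀ n m', IsExp d M n m' →
    m ≠ expo d 0 + m' ∧ m ≠ expo d d + m' := by
  obtain ⟨u, hu, h⟩ := T.exists_not
  have hle := hu.le T.le
  have hexp : IsExp d M e (Finsupp.single 0 u + Finsupp.single 1 (e * d - u)) := by
    refine ⟨?_, ?_⟩
    · simp; omega
    · simpa using hu
  refine ⟨_, hexp, fun n m' h' => ⟨fun heq => ?_, fun heq => ?_⟩⟩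
  · have h1 := (isExp_expo T.le T.mem_zero).add h'
    rw [← heq] at h1
    have h2 := h1.congr_degree T.pos hexp
    refine (h n (by omega)).1 ?_
    have h3 := DFunLike.congr_fun heq 0
    rw [Finsupp.add_apply, Finsupp.add_apply, expo_zero] at h3
    simp at h3
    rw [h3]; exact h'.2
  · have h1 := (isExp_expo T.le T.mem_d).add h'
    rw [← heq] at h1
    have h2 := h1.congr_degree T.pos hexp
    have h3 := DFunLike.congr_fun heq 0
    rw [Finsupp.add_apply, Finsupp.add_apply, expo_zero] at h3
    simp at h3
    exact (h n (by omega)).2 _ h3 h'.2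

variable (k : Type*) [Field k]

/-- If `x ^ d * f = y ^ d * g` in the ring then `f` is a multiple of `y ^ d`. -/
theorem exists_eq_gen_mul {n : ℕ} {f g : ring k d M} (hf : f ∈ piece k d M n)
    (hg : g ∈ piece k d M n) (h : gen T.mem_d * f = gen T.mem_zero * g) (h0 : f ≠ 0) :
    ∃ n', n = n' + 1 ∧ ∃ w ∈ piece k d M n', f = gen T.mem_zero * w := by
  have key : ∀ m ∈ (f : MvPolynomial (Fin 2) k).support,
      ∃ n', n = n' + 1 ∧ ∃ m', m = expo d 0 + m' ∧ IsExp d M n' m' := by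
    intro m hm
    have h1 := isExp_of_mem_piece T.le T.pos hf hm
    have h2 := coeff_add_gen_mul T.mem_d f m
    rw [h, coeff_gen_mul] at h2
    split_ifs at h2 with hle
    · have h3 : expo d d + m - expo d 0 ∈ (g : MvPolynomial (Fin 2) k).support := by
        rw [mem_support_iff, h2]; exact mem_support_iff.1 hm
      have h4 := (isExp_of_mem_piece T.le T.pos hg h3).2
      rw [Finsupp.tsub_apply, Finsupp.add_apply, expo_zero, expo_zero, tsub_zero, add_comm] at h4
      have hpos := T.pos
      obtain _ | n' := n
      · have h5 : m 0 + d = 0 := h4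
        omega
      · exact ⟨n', rfl, h1.exists_of_isSum T.le T.mem_zero (zero_add _).symm
          (T.cancel n' _ h1.2 h4)⟩
    · exact absurd h2.symm (mem_support_iff.1 hm)
  obtain ⟨m, hm⟩ : (f : MvPolynomial (Fin 2) k).support.Nonempty := by
    rw [support_nonempty]
    exact fun h => h0 (Subtype.ext h)
  obtain ⟨n', rfl, -⟩ := key m hm
  refine ⟨n', rfl, ?_⟩
  let w : MvPolynomial (Fin 2) k := (f : MvPolynomial (Fin 2) k).divMonomial (expo d 0)
  have hw : ∀ m ∈ w.support, IsExp d M n' m := by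
    intro m hm
    rw [mem_support_iff, coeff_divMonomial] at hm
    obtain ⟨n'', hn, m', hm', h'⟩ := key _ (mem_support_iff.2 hm)
    obtain rfl := add_left_cancel hm'
    obtain rfl := Nat.succ_injective hn
    exact h'
  refine ⟨⟨w, mem_ring_of_isExp T.le fun m hm => ⟨n', hw m hm⟩⟩, mem_piece_of_isExp hw, ?_⟩
  apply Subtype.ext
  ext m
  rw [coeff_gen_mul]
  split_ifs with hle
  · change _ = coeff _ w
    rw [coeff_divMonomial, add_tsub_cancel_of_le hle]
  · by_contra hne
    obtain ⟨_, -, m', rfl, -⟩ := key m (mem_support_iff.2 hne)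
    exact hle le_self_add

/-- The graded presentation of the ring. -/
noncomputable abbrev pres : GradedFree.GradedPresentation (presentation k d M) (piece k d M) :=
  gradedPresentation T.le T.pos

/-- The operators given by `x ^ d` and `y ^ d`. -/
abbrev parameters : List {α // α ∈ M} := [⟨d, T.mem_d⟩, ⟨0, T.mem_zero⟩]

/-- R is a domain, so y^d is regular, and `exists_eq_gen_mul` makes x^d regular modulo y^d. -/
theorem acyclic (i a : ℤ) (hi : i ≠ 0) : (T.pres k).grading.Vanishes T.parameters i a := by
  refine OperatorGrading.acyclic_cons (OperatorGrading.acyclic_cons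
    OperatorGrading.acyclic_nil ?_) ?_ i a hi
  · intro a f _ h
    rw [OperatorGrading.boundary_nil, AddSubgroup.mem_bot, grading_x] at h
    rw [OperatorGrading.boundary_nil, AddSubgroup.mem_bot]
    exact (mul_eq_zero.1 h).resolve_left (gen_ne_zero T.mem_zero)
  · intro a f hf h
    rw [OperatorGrading.boundary_cons, OperatorGrading.boundary_nil, bot_sup_eq] at h ⊢
    rw [add_sub_cancel_right] at h
    obtain ⟨g, hg, e⟩ := h
    rw [grading_x, grading_x] at e
    by_cases h0 : f = 0
    · rw [h0]; exact zero_mem _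
    obtain ⟨n, rfl, hf⟩ := ((mem_grading_deg _ _).1 hf).resolve_left h0
    have hg : g ∈ piece k d M n := by
      rcases (mem_grading_deg _ _).1 hg with rfl | ⟨n', hn, h⟩
      · exact zero_mem _
      · rwa [Nat.cast_injective hn] at h
    obtain ⟨n', rfl, w, hw, rfl⟩ := T.exists_eq_gen_mul k hf hg e.symm h0
    exact ⟨w, (mem_grading_deg _ _).2 (Or.inr ⟨n', by push_cast; ring, hw⟩),
      grading_x _ _ _ _⟩

theorem mem_boundary_iff {a : ℤ} {f : ring k d M} :
    f ∈ (T.pres k).grading.boundary T.parameters a ↔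
      ∃ g ∈ (T.pres k).grading.deg (a - 1), ∃ h ∈ (T.pres k).grading.deg (a - 1),
        f = gen T.mem_zero * g + gen T.mem_d * h := by
  rw [OperatorGrading.boundary_cons, OperatorGrading.boundary_cons, OperatorGrading.boundary_nil,
    bot_sup_eq, AddSubgroup.mem_sup]
  constructor
  · rintro ⟨_, ⟨g, hg, rfl⟩, _, ⟨h, hh, rfl⟩, rfl⟩
    exact ⟨g, hg, h, hh, by rw [grading_x, grading_x]⟩
  · rintro ⟨g, hg, h, hh, rfl⟩
    exact ⟨_, ⟨g, hg, grading_x _ _ _ _⟩, _, ⟨h, hh, grading_x _ _ _ _⟩, rfl⟩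

/-- The only homology is R/Q, and above degree e each monomial is a multiple of x^d or y^d. -/
theorem vanishes_parameters (i a : ℤ) (ha : (e : ℤ) < a) :
    (T.pres k).grading.Vanishes T.parameters i a := by
  by_cases hi : i = 0
  · subst hi
    rw [OperatorGrading.vanishes_zero_iff]
    intro f hf
    rcases (mem_grading_deg _ _).1 hf with rfl | ⟨n, rfl, hf⟩
    · exact zero_mem _
    obtain ⟨n, rfl⟩ : ∃ n', n = n' + 1 := ⟨n - 1, by omega⟩
    refine mem_of_monomialElt_mem T.le (p := fun j => j = n + 1)
      (fun m hm => ⟨n + 1, rfl, isExp_of_mem_piece T.le T.pos hf hm⟩) ?_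
    rintro _ rfl m hm c
    obtain ⟨α, hα, hα', m', rfl, h'⟩ := T.exists_isExp_of_le (n := n) (by omega) hm
    have hdeg : monomialElt T.le h' c ∈ (T.pres k).grading.deg ((n + 1 : ℕ) - 1) :=
      (mem_grading_deg _ _).2 (Or.inr ⟨n, by push_cast; ring, monomialElt_mem_piece T.le h' c⟩)
    rw [← gen_mul_monomialElt T.le hα h', mem_boundary_iff]
    rcases hα' with rfl | rfl
    · exact ⟨_, hdeg, 0, zero_mem _, by rw [mul_zero, add_zero]⟩
    · exact ⟨0, zero_mem _, _, hdeg, by rw [mul_zero, zero_add]⟩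
  · exact T.acyclic k i a hi

theorem not_vanishes_parameters : ¬ (T.pres k).grading.Vanishes T.parameters 0 e := by
  rw [OperatorGrading.vanishes_zero_iff]
  intro h
  obtain ⟨m, hm, hnot⟩ := T.exists_isExp_not
  have hmem := h ((mem_grading_deg _ _).2
    (Or.inr ⟨e, rfl, monomialElt_mem_piece (k := k) T.le hm 1⟩))
  rw [mem_boundary_iff] at hmem
  obtain ⟨f, -, g, -, heq⟩ := hmem
  have hc : coeff m ((gen T.mem_zero * f + gen T.mem_d * g : ring k d M) :
      MvPolynomial (Fin 2) k) ≠ 0 := by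
    rw [← heq]
    change coeff m (monomial m 1) ≠ 0
    simp
  obtain ⟨n, m', h1, h2⟩ := exists_of_coeff_ne_zero T.le _ _ hc
  exact h2.elim (hnot n m' h1).1 (hnot n m' h1).2

theorem vanishes_append (l : List {α // α ∈ M}) (i a : ℤ) (ha : (e : ℤ) < a) :
    (T.pres k).grading.Vanishes (l ++ T.parameters) i a := by
  induction l generalizing i with
  | nil => exact T.vanishes_parameters k i a ha
  | cons s l ih => exact (ih i).cons (ih (i - 1)) s

/-- The class in R/Q of degree e moves up one homological degree with each further variable. -/
theorem not_vanishes_append (l : List {α // α ∈ M}) :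
    ¬ (T.pres k).grading.Vanishes (l ++ T.parameters) l.length e := by
  induction l with
  | nil => exact T.not_vanishes_parameters k
  | cons s l ih =>
    have := OperatorGrading.not_vanishes_cons ih (T.vanishes_append k l _ _ (by omega)) s
    rwa [List.length_cons, Nat.cast_succ]

/-- The regularity of the ring. -/
theorem isReg : IsReg k d M e := by
  classical
  -- The variables other than the two parameters, so that `l ++ T.parameters` lists each variable
  -- once.
  let l : List {α // α ∈ M} := M.attach.toList.filter fun α => α ∉ T.parameters
  refine (T.pres k).isCastelnuovoMumfordRegularity (l := l ++ T.parameters) ?_ ?_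
    (T.vanishes_append k l) (T.not_vanishes_append k l)
  · intro s
    rw [List.mem_append, List.mem_filter]
    by_cases h : s ∈ T.parameters
    · exact Or.inr h
    · exact Or.inl ⟨by simp, by simpa using h⟩
  · refine List.Nodup.append (M.attach.nodup_toList.filter _) ?_ ?_
    · have := T.pos.ne'
      simpa using this
    · intro s hs hs'
      rw [List.mem_filter] at hs
      simp only [decide_not, Bool.not_eq_true', decide_eq_false_iff_not] at hs
      exact hs.2 hs'

end HasTopDegree

end MonomialCurve

/-! ### Powers of R_+ and the reduction number -/

namespace MonomialCurve

section

variable {k : Type*} [Field k] {d : ℕ} {M : Finset ℕ}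

/-- The ideal of elements all of whose terms have degree at least `n`. -/
def tailIdeal (k : Type*) [Field k] (d : ℕ) {M : Finset ℕ} (hM : ∀ α ∈ M, α ≤ d) (n : ℕ) :
    Ideal (ring k d M) where
  carrier := {f | ∀ m ∈ (f : MvPolynomial (Fin 2) k).support, ∃ j, n ≤ j ∧ IsExp d M j m}
  zero_mem' m hm := by simp at hm
  add_mem' {f g} hf hg m hm := by
    classical
    rcases Finset.mem_union.1 (support_add hm) with h | h
    · exact hf m h
    · exact hg m h
  smul_mem' f g hg m hm := by
    classical
    obtain ⟨m₁, h₁, m₂, h₂, rfl⟩ := Finset.mem_add.1 (support_mul _ _ hm)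
    obtain ⟨n₁, e₁⟩ := isExp_of_mem_ring hM f.2 _ h₁
    obtain ⟨n₂, h, e₂⟩ := hg _ h₂
    exact ⟨_, by omega, e₁.add e₂⟩

theorem gen_mem_irrelevant (hM : ∀ α ∈ M, α ≤ d) {α : ℕ} (h : α ∈ M) :
    gen h ∈ irrelevant k d M :=
  Ideal.subset_span ⟨1, le_rfl, by
    rw [mem_piece_iff, one_mul]; exact isHomogeneous_mon hM h⟩

theorem monomialElt_mem_irrelevant_pow (hM : ∀ α ∈ M, α ≤ d) {n : ℕ} {m : Fin 2 →₀ ℕ}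
    (h : IsExp d M n m) (c : k) : monomialElt hM h c ∈ irrelevant k d M ^ n := by
  induction n generalizing m with
  | zero => rw [pow_zero, Ideal.one_eq_top]; trivial
  | succ n ih =>
    obtain ⟨α, hα, m', rfl, h'⟩ := h.exists_eq_add hM
    rw [← gen_mul_monomialElt hM hα h', pow_succ']
    exact Ideal.mul_mem_mul (gen_mem_irrelevant hM hα) (ih h')

theorem irrelevant_pow (hM : ∀ α ∈ M, α ≤ d) (hd : 0 < d) (n : ℕ) :
    irrelevant k d M ^ n = tailIdeal k d hM n := by
  classical
  refine le_antisymm ?_ fun f hf => ?_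
  · induction n with
    | zero =>
      intro f _ m hm
      obtain ⟨j, hj⟩ := isExp_of_mem_ring hM f.2 m hm
      exact ⟨j, j.zero_le, hj⟩
    | succ n ih =>
      have h1 : irrelevant k d M ≤ tailIdeal k d hM 1 := by
        refine Ideal.span_le.2 ?_
        rintro f ⟨j, hj, hf⟩ m hm
        exact ⟨j, hj, isExp_of_mem_piece hM hd hf hm⟩
      rw [pow_succ]
      refine Ideal.mul_le.2 fun f hf g hg m hm => ?_
      obtain ⟨m₁, h₁, m₂, h₂, rfl⟩ := Finset.mem_add.1 (support_mul _ _ hm)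
      obtain ⟨n₁, l₁, e₁⟩ := ih hf _ h₁
      obtain ⟨n₂, l₂, e₂⟩ := h1 hg _ h₂
      exact ⟨_, by omega, e₁.add e₂⟩
  · refine mem_of_monomialElt_mem hM (B := (irrelevant k d M ^ n).toAddSubgroup) hf ?_
    intro j hj m hm c
    exact Ideal.pow_le_pow_right hj (monomialElt_mem_irrelevant_pow hM hm c)

theorem Q_eq_span (h0 : 0 ∈ M) (hd : d ∈ M) :
    Q k d M = Ideal.span {gen h0, gen hd} := by
  rw [Q]
  congr 1
  ext f
  have e0 : ((gen h0 : ring k d M) : MvPolynomial (Fin 2) k) = X 1 ^ d := by simp [gen, mon]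
  have ed : ((gen hd : ring k d M) : MvPolynomial (Fin 2) k) = X 0 ^ d := by simp [gen, mon]
  change (_ = _ ∨ _ = _) ↔ (f = _ ∨ f = _)
  rw [Subtype.ext_iff, Subtype.ext_iff, e0, ed, or_comm]

end

namespace HasTopDegree

variable {d : ℕ} {M : Finset ℕ} {e : ℕ} (T : HasTopDegree d M e) (k : Type*) [Field k]

include T

theorem gen_mem_Q {α : ℕ} (h : α ∈ M) (h' : α = 0 ∨ α = d) : gen h ∈ Q k d M := by
  rw [Q_eq_span T.mem_zero T.mem_d]
  rcases h' with rfl | rfl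
  · exact Ideal.subset_span (Or.inl rfl)
  · exact Ideal.subset_span (Or.inr rfl)

theorem Q_le_irrelevant : Q k d M ≤ irrelevant k d M := by
  rw [Q_eq_span T.mem_zero T.mem_d, Ideal.span_le]
  rintro f (rfl | rfl)
  · exact gen_mem_irrelevant T.le _
  · exact gen_mem_irrelevant T.le _

/-- The reduction number of the ring. -/
theorem isRedNumber : IsRedNumber k d M e := by
  refine ⟨T.Q_le_irrelevant k, ?_, ?_⟩
  · refine le_antisymm ?_ fun f hf => ?_
    · rw [pow_succ']
      exact Ideal.mul_mono_left (T.Q_le_irrelevant k)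
    · rw [irrelevant_pow T.le T.pos] at hf
      refine mem_of_monomialElt_mem T.le
        (B := (Q k d M * irrelevant k d M ^ e).toAddSubgroup) hf ?_
      intro j hj m hm c
      obtain ⟨j, rfl⟩ : ∃ j', j = j' + 1 := ⟨j - 1, by omega⟩
      obtain ⟨α, hα, hα', m', rfl, h'⟩ := T.exists_isExp_of_le (n := j) (by omega) hm
      rw [← gen_mul_monomialElt T.le hα h']
      exact Ideal.mul_mem_mul (T.gen_mem_Q k hα hα')
        (Ideal.pow_le_pow_right (by omega) (monomialElt_mem_irrelevant_pow T.le h' c))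
  · intro n hn
    by_contra hne
    obtain ⟨t, rfl⟩ : ∃ t, e = n + 1 + t := ⟨e - (n + 1), by omega⟩
    have hn : Q k d M * irrelevant k d M ^ n = irrelevant k d M ^ (n + 1) := hn
    -- Equality at some n < e would put all of R_+^e into Q, contrary to the monomial of degree e
    -- outside Q.
    have hle : irrelevant k d M ^ (n + 1 + t) ≤ Q k d M := by
      rw [pow_add, ← hn, mul_assoc]
      exact Ideal.mul_le_left
    obtain ⟨m, hm, hnot⟩ := T.exists_isExp_not
    have hmem := hle (monomialElt_mem_irrelevant_pow T.le hm (1 : k))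
    rw [Q_eq_span T.mem_zero T.mem_d, Ideal.mem_span_pair] at hmem
    obtain ⟨f, g, heq⟩ := hmem
    rw [mul_comm f, mul_comm g] at heq
    have hc : coeff m ((gen T.mem_zero * f + gen T.mem_d * g : ring k d M) :
        MvPolynomial (Fin 2) k) ≠ 0 := by
      rw [heq]
      change coeff m (monomial m 1) ≠ 0
      simp
    obtain ⟨n, m', h1, h2⟩ := exists_of_coeff_ne_zero T.le _ _ hc
    exact h2.elim (hnot n m' h1).1 (hnot n m' h1).2

end HasTopDegree

end MonomialCurve

/-! ### Sums of elements of {0, d} ∪ [a, b] -/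

namespace MonomialCurve

/-- A sum of exponents is given by the number of middle exponents and the number of exponents
`d`. -/
theorem isSum_exponents_iff {a b d : ℕ} (hab : a ≤ b) (hbd : b ≤ d) {n u : ℕ} :
    IsSum (exponents a b d) n u ↔
      ∃ i j, i + j ≤ n ∧ i * a + j * d ≤ u ∧ u ≤ i * b + j * d := by
  have hmem : ∀ α, α ∈ exponents a b d ↔ (α = 0 ∨ α = d) ∨ (a ≤ α ∧ α ≤ b) := by
    intro α; simp [exponents, or_assoc]
  induction n generalizing u with
  | zero =>
    constructor
    · rintro (rfl : u = 0)
      exact ⟨0, 0, le_rfl, by simp, by simp⟩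
    · rintro ⟨i, j, h, -, h'⟩
      obtain ⟨rfl, rfl⟩ : i = 0 ∧ j = 0 := by omega
      change u = 0
      simpa using h'
  | succ n ih =>
    constructor
    · rintro ⟨α, hα, v, rfl, hv⟩
      obtain ⟨i, j, h, h1, h2⟩ := ih.1 hv
      rcases (hmem α).1 hα with (rfl | rfl) | ⟨ha, hb⟩
      · exact ⟨i, j, by omega, by omega, by omega⟩
      · exact ⟨i, j + 1, by omega, by rw [Nat.succ_mul]; omega, by rw [Nat.succ_mul]; omega⟩
      · exact ⟨i + 1, j, by omega, by rw [Nat.succ_mul]; omega, by rw [Nat.succ_mul]; omega⟩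
    · rintro ⟨i, j, h, h1, h2⟩
      by_cases hn : i + j ≤ n
      · exact ⟨0, (hmem 0).2 (by simp), u, (zero_add u).symm, ih.2 ⟨i, j, hn, h1, h2⟩⟩
      obtain _ | j := j
      · obtain rfl : i = n + 1 := by omega
        rw [Nat.succ_mul] at h1 h2
        have hle : n * a ≤ n * b := Nat.mul_le_mul_left n hab
        -- The least summand in [a, b] that leaves at most nb for the other n summands; what is left
        -- is still at least na.
        refine ⟨max a (u - n * b), (hmem _).2 (Or.inr ⟨le_max_left _ _, ?_⟩),
          u - max a (u - n * b), ?_, ih.2 ⟨n, 0, le_rfl, ?_, ?_⟩⟩ <;> omega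
      · rw [Nat.succ_mul] at h1 h2
        exact ⟨d, (hmem d).2 (by simp), u - d, by omega,
          ih.2 ⟨i, j, by omega, by omega, by omega⟩⟩

variable {a b d : ℕ}

/-- If u + d uses a summand d, drop it. Otherwise u + d ≤ (n+1)b, so u < nb because b < d; and if u
needs all n+1 nonzero summands, then u ≥ na, so n summands from [a, b] suffice. -/
theorem exponents_cancel (hab : a < b) (hbd : b < d) (n u : ℕ)
    (h : IsSum (exponents a b d) (n + 1) u) (h' : IsSum (exponents a b d) (n + 1) (u + d)) :
    IsSum (exponents a b d) n u := by
  rw [isSum_exponents_iff hab.le hbd.le] at *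
  obtain ⟨i, j, h1, h2, h3⟩ := h
  obtain ⟨i', j', h1', h2', h3'⟩ := h'
  obtain _ | j' := j'
  · have e1 : i' * b ≤ (n + 1) * b := Nat.mul_le_mul_right b (by omega)
    rw [Nat.succ_mul] at e1
    by_cases hij : i + j ≤ n
    · exact ⟨i, j, hij, h2, h3⟩
    · have e2 : n * a ≤ i * a + j * d := by
        have : j * a ≤ j * d := Nat.mul_le_mul_left j (by omega)
        have : n * a ≤ (i + j) * a := Nat.mul_le_mul_right a (by omega)
        rw [add_mul] at this
        omega
      exact ⟨n, 0, le_rfl, by omega, by omega⟩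
  · rw [Nat.succ_mul] at h2' h3'
    exact ⟨i', j', by omega, by omega, by omega⟩

theorem mem_exponents_le (hbd : b < d) : ∀ α ∈ exponents a b d, α ≤ d := by
  intro α h
  simp only [exponents, Finset.mem_union, Finset.mem_insert, Finset.mem_singleton,
    Finset.mem_Icc] at h
  omega

/-- Here g bounds the gaps of the intervals [ia, ib], and `he` pushes u - d past them as soon as u >
eb. -/
theorem hasTopDegree_exponents (hab : a < b) (hbd : b < d) {e g : ℕ}
    (hgap : ∀ v, g ≤ v → ∃ i, i * a ≤ v ∧ v ≤ i * b)
    (he : d + g ≤ e * b + 1)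
    (hnot : ∃ u, IsSum (exponents a b d) e u ∧ ∀ n, n + 1 = e →
      ¬ IsSum (exponents a b d) n u ∧ ∀ v, u = d + v → ¬ IsSum (exponents a b d) n v) :
    HasTopDegree d (exponents a b d) e where
  pos := by omega
  le := mem_exponents_le hbd
  mem_zero := by simp [exponents]
  mem_d := by simp [exponents]
  cancel := exponents_cancel hab hbd
  exists_not := hnot
  top := by
    intro n u hn h
    rw [isSum_exponents_iff hab.le hbd.le] at h
    obtain ⟨i, j, h1, h2, h3⟩ := h
    by_cases hij : i + j ≤ n
    · exact Or.inl ((isSum_exponents_iff hab.le hbd.le).2 ⟨i, j, hij, h2, h3⟩)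
    obtain _ | j := j
    · obtain rfl : i = n + 1 := by omega
      rw [Nat.succ_mul] at h2 h3
      by_cases hu : u ≤ n * b
      · exact Or.inl ((isSum_exponents_iff hab.le hbd.le).2 ⟨n, 0, le_rfl, by omega, by omega⟩)
      · have e1 : e * b ≤ n * b := Nat.mul_le_mul_right b hn
        obtain ⟨i, hi, hi'⟩ := hgap (u - d) (by omega)
        refine Or.inr ⟨u - d, by omega, (isSum_exponents_iff hab.le hbd.le).2 ?_⟩
        -- If i > n, then u - d ≥ na, while u ≤ (n+1)b and b < d give u - d < nb, so n summands
        -- suffice.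
        by_cases hin : i ≤ n
        · exact ⟨i, 0, hin, by omega, by omega⟩
        · have : n * a ≤ i * a := Nat.mul_le_mul_right a (by omega)
          exact ⟨n, 0, le_rfl, by omega, by omega⟩
    · rw [Nat.succ_mul] at h2 h3
      exact Or.inr ⟨u - d, by omega, (isSum_exponents_iff hab.le hbd.le).2
        ⟨i, j, by omega, by omega, by omega⟩⟩

/-- From some point on the intervals `[i * a, i * b]` cover. -/
theorem exists_mul_le_of_le {t : ℕ} (ha : 0 < a) (hab : a < b) (ht : (t + 1) * a ≤ t * b + 1)
    (v : ℕ) (hv : t * a ≤ v) : ∃ i, i * a ≤ v ∧ v ≤ i * b := by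
  -- The largest i with ia ≤ v. Once the intervals for t and t + 1 leave no gap, neither do later
  -- ones, since a < b; thus v < (i+1)a ≤ ib + 1.
  refine ⟨v / a, Nat.div_mul_le_self v a, ?_⟩
  have h1 : t ≤ v / a := (Nat.le_div_iff_mul_le ha).2 hv
  obtain ⟨s, hs⟩ := Nat.exists_eq_add_of_le h1
  have h2 : v < (v / a + 1) * a := by
    rw [add_mul, one_mul]; exact Nat.lt_div_mul_add ha
  rw [hs] at h2 ⊢
  have : s * a ≤ s * b := Nat.mul_le_mul_left s hab.le
  have e1 : (t + s + 1) * a = (t + 1) * a + s * a := by ring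
  have e2 : (t + s) * b = t * b + s * b := by ring
  omega

/-- The witness is u = d + v with v a gap. It is too large for f summands without d, and removing
one d leaves v, which is not a sum at all: one summand d would force v = d or v ≥ d + a, and two
would force v ≥ 2d. -/
theorem exists_not_isSum (hab : a < b) (hbd : b < d) {f v : ℕ} (h1 : f * b < d + v)
    (h2 : (f + 1) * a ≤ d + v) (h3 : d + v ≤ (f + 1) * b)
    (hv : ∀ i, ¬ (i * a ≤ v ∧ v ≤ i * b)) (hvd : v ≠ d) (hva : v < d + a) :
    ∃ u, IsSum (exponents a b d) (f + 1) u ∧ ∀ n, n + 1 = f + 1 →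
      ¬ IsSum (exponents a b d) n u ∧ ∀ w, u = d + w → ¬ IsSum (exponents a b d) n w := by
  have key : ∀ i j, i * a + j * d ≤ v → v ≤ i * b + j * d → False := by
    intro i j hi hi'
    obtain _ | _ | j := j
    · exact hv i ⟨by omega, by omega⟩
    · obtain _ | i := i
      · omega
      · rw [Nat.succ_mul] at hi; omega
    · rw [Nat.succ_mul, Nat.succ_mul] at hi; omega
  refine ⟨d + v, (isSum_exponents_iff hab.le hbd.le).2 ⟨f + 1, 0, le_rfl, by omega, by omega⟩, ?_⟩
  intro n hn
  obtain rfl : n = f := by omega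
  refine ⟨fun h => ?_, fun w hw h => ?_⟩
  · obtain ⟨i, j, hij, h4, h5⟩ := (isSum_exponents_iff hab.le hbd.le).1 h
    obtain _ | j := j
    · have : i * b ≤ n * b := Nat.mul_le_mul_right b (by omega)
      omega
    · rw [Nat.succ_mul] at h4 h5
      exact key i j (by omega) (by omega)
  · obtain rfl : v = w := by omega
    obtain ⟨i, j, hij, h4, h5⟩ := (isSum_exponents_iff hab.le hbd.le).1 h
    exact key i j h4 h5

theorem not_mul_le_of_lt {v t : ℕ} (h1 : t * b < v) (h2 : v < (t + 1) * a) (i : ℕ) :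
    ¬ (i * a ≤ v ∧ v ≤ i * b) := by
  rintro ⟨h, h'⟩
  by_cases hi : i ≤ t
  · have : i * b ≤ t * b := Nat.mul_le_mul_right b hi
    omega
  · have : (t + 1) * a ≤ i * a := Nat.mul_le_mul_right a (by omega)
    omega

/-- Since 2a ≤ b + 1, the intervals cover everything from a on, and a - 1 is the last gap. -/
theorem hasTopDegree_of_two_mul_le (ha : 2 ≤ a) (hab : a < b) (hbd : b + 2 ≤ d)
    (h : 2 * a ≤ b + 1) {f : ℕ} (h1 : f * b + 2 ≤ a + d) (h2 : a + d ≤ (f + 1) * b + 1) :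
    HasTopDegree d (exponents a b d) (f + 1) := by
  refine hasTopDegree_exponents hab (by omega) (g := a)
    (fun v hv => exists_mul_le_of_le (t := 1) (by omega) hab (by omega) v (by omega)) (by omega) ?_
  refine exists_not_isSum hab (by omega) (v := a - 1) (by omega) ?_ (by omega)
    (not_mul_le_of_lt (t := 0) (by omega) (by omega)) (by omega) (by omega)
  rw [Nat.succ_mul]
  obtain _ | _ | f := f
  · omega
  · omega
  · have e1 : (f + 2) * (2 * a) ≤ (f + 2) * (b + 1) := Nat.mul_le_mul_left _ h
    have e2 : f * 1 ≤ f * a := Nat.mul_le_mul_left f (by omega)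
    ring_nf at *
    omega

/-- Since 3a ≤ 2b + 1, the intervals cover everything from 2a on, and b + 1 < 2a makes 2a - 1 the
last gap. -/
theorem hasTopDegree_of_three_mul_le (ha : 2 ≤ a) (hab : a < b) (hbd : b + 2 ≤ d)
    (h : 3 * a ≤ 2 * b + 1) (h' : b + 1 < 2 * a) {f : ℕ} (h1 : f * b + 2 ≤ 2 * a + d)
    (h2 : 2 * a + d ≤ (f + 1) * b + 1) : HasTopDegree d (exponents a b d) (f + 1) := by
  refine hasTopDegree_exponents hab (by omega) (g := 2 * a)
    (fun v hv => exists_mul_le_of_le (t := 2) (by omega) hab (by omega) v (by omega)) (by omega) ?_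
  -- The gap 2a - 1 is then d itself, a sum. The value 2a - 2 is still a gap because b ≤ d - 2 = 2a
  -- - 3, and the inequalities survive the loss of one since f ≤ 2.
  by_cases hd : d = 2 * a - 1
  · have hf : f ≤ 2 := by
      by_contra hf
      have : 3 * b ≤ f * b := Nat.mul_le_mul_right b (by omega)
      omega
    refine exists_not_isSum hab (by omega) (v := 2 * a - 2) ?_ ?_ (by omega)
      (not_mul_le_of_lt (t := 1) (by omega) (by omega)) (by omega) (by omega)
    · interval_cases f <;> omega
    · interval_cases f <;> omega
  · refine exists_not_isSum hab (by omega) (v := 2 * a - 1) (by omega) ?_ (by omega)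
      (not_mul_le_of_lt (t := 1) (by omega) (by omega)) (by omega) (by omega)
    rw [Nat.succ_mul]
    obtain _ | _ | f := f
    · omega
    · omega
    · have e1 : (f + 2) * (3 * a) ≤ (f + 2) * (2 * b + 1) := Nat.mul_le_mul_left _ h
      have e2 : f * 1 ≤ f * a := Nat.mul_le_mul_left f (by omega)
      ring_nf at *
      omega

theorem exists_ceil_eq {N b : ℕ} (hN : 0 < N) (hb : 0 < b) :
    ∃ f : ℕ, f * b + 1 ≤ N ∧ N ≤ (f + 1) * b ∧ ⌈(N : ℚ) / b⌉ = (f + 1 : ℕ) := by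
  have h1 := Nat.div_mul_le_self (N - 1) b
  have h2 : N - 1 < ((N - 1) / b + 1) * b := by
    rw [add_mul, one_mul]; exact Nat.lt_div_mul_add hb
  have h3 : (N - 1) / b * b + 1 ≤ N := by omega
  have h4 : N ≤ ((N - 1) / b + 1) * b := by omega
  refine ⟨(N - 1) / b, h3, h4, ?_⟩
  have hb' : (0 : ℚ) < b := by exact_mod_cast hb
  generalize (N - 1) / b = f at *
  rw [Int.ceil_eq_iff, lt_div_iff₀ hb', div_le_iff₀ hb']
  constructor
  · have : f * b < N := by omega
    have : (f * b : ℚ) < N := by exact_mod_cast this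
    push_cast; linarith
  · exact_mod_cast h4

end MonomialCurve

/-! ### Cohen–Macaulayness at every maximal ideal -/

namespace MonomialCurve

section Polynomial

variable {k : Type*} [Field k]

/-- Nonzero polynomials in powers of the two different variables are relatively prime. -/
theorem isRelPrime_aeval_pow {d : ℕ} (f g : Polynomial k)
    (hf : Polynomial.aeval (X 0 ^ d : MvPolynomial (Fin 2) k) f ≠ 0)
    (hg : Polynomial.aeval (X 1 ^ d : MvPolynomial (Fin 2) k) g ≠ 0) :
    IsRelPrime (Polynomial.aeval (X 0 ^ d : MvPolynomial (Fin 2) k) f)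
      (Polynomial.aeval (X 1 ^ d : MvPolynomial (Fin 2) k) g) := by
  -- A divisor of a nonzero polynomial in one variable does not involve the other, as degrees add. A
  -- common divisor is therefore constant.
  have aux : ∀ (i j : Fin 2) (q : Polynomial k), j ≠ i → ∀ p : MvPolynomial (Fin 2) k,
      Polynomial.aeval (X i ^ d : MvPolynomial (Fin 2) k) q ≠ 0 →
      p ∣ Polynomial.aeval (X i ^ d : MvPolynomial (Fin 2) k) q → p.degreeOf j = 0 := by
    intro i j q hij p h0 hp
    obtain ⟨r, hr⟩ := hp
    have h1 : Polynomial.aeval (X i ^ d : MvPolynomial (Fin 2) k) q ∈ supported k ({i} : Set (Fin 2)) := by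
      have hX : (X i ^ d : MvPolynomial (Fin 2) k) ∈ supported k ({i} : Set (Fin 2)) :=
        (supported k ({i} : Set (Fin 2))).pow_mem (X_mem_supported.2 (Set.mem_singleton i)) d
      rw [Polynomial.aeval_eq_sum_range]
      exact sum_mem fun n _ => Subalgebra.smul_mem _ (Subalgebra.pow_mem _ hX n) _
    have h2 : (Polynomial.aeval (X i ^ d : MvPolynomial (Fin 2) k) q).degreeOf j = 0 := by
      classical
      rw [degreeOf_def, Multiset.count_eq_zero]
      intro hj
      have h3 : j ∈ (Polynomial.aeval (X i ^ d : MvPolynomial (Fin 2) k) q).vars := by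
        rw [vars_def]; exact Multiset.mem_toFinset.2 hj
      exact hij (mem_supported.1 h1 h3)
    rw [hr] at h0 h2
    rw [degreeOf_mul_eq (left_ne_zero_of_mul h0) (right_ne_zero_of_mul h0)] at h2
    omega
  intro p hp hp'
  have h0 := aux 1 0 g (by decide) p hg hp'
  have h1 := aux 0 1 f (by decide) p hf hp
  have hv : p.vars = ∅ := by
    classical
    rw [Finset.eq_empty_iff_forall_notMem]
    intro i hi
    rw [vars_def, Multiset.mem_toFinset, ← Multiset.count_ne_zero, ← degreeOf_def] at hi
    fin_cases i
    · exact hi h0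
    · exact hi h1
  have hp0 : p ≠ 0 := by
    rintro rfl
    exact hf (zero_dvd_iff.1 hp)
  rw [vars_eq_empty_iff_eq_C] at hv
  rw [hv] at hp0 ⊢
  exact (isUnit_iff_ne_zero.2 fun h => hp0 (by rw [h, C_0])).map C

theorem coeff_sum_filter_monomial (P : (Fin 2 →₀ ℕ) → Prop) [DecidablePred P]
    (f : MvPolynomial (Fin 2) k) (m : Fin 2 →₀ ℕ) :
    coeff m (∑ m ∈ f.support with P m, monomial m (coeff m f)) = if P m then coeff m f else 0 := by
  classical
  rw [coeff_sum]
  simp only [coeff_monomial]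
  rw [Finset.sum_ite_eq']
  by_cases hP : P m <;> by_cases hm : coeff m f = 0 <;> simp [hP, hm]

/-- The terms of `f` whose exponents satisfy a predicate. -/
noncomputable def termsOf (P : (Fin 2 →₀ ℕ) → Prop) [DecidablePred P] :
    MvPolynomial (Fin 2) k →+ MvPolynomial (Fin 2) k :=
  AddMonoidHom.mk' (fun f => ∑ m ∈ f.support with P m, monomial m (coeff m f)) fun f g => by
    ext m
    rw [coeff_add, coeff_sum_filter_monomial, coeff_sum_filter_monomial, coeff_sum_filter_monomial]
    split_ifs
    · exact coeff_add _ _ _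
    · exact (add_zero _).symm

theorem coeff_termsOf (P : (Fin 2 →₀ ℕ) → Prop) [DecidablePred P] (f : MvPolynomial (Fin 2) k)
    (m : Fin 2 →₀ ℕ) : coeff m (termsOf P f) = if P m then coeff m f else 0 :=
  coeff_sum_filter_monomial P f m

/-- If a predicate is invariant under `c`, taking the terms that satisfy it commutes with
multiplication by polynomials in the monomial of exponent `c`. -/
theorem termsOf_aeval_mul (P : (Fin 2 →₀ ℕ) → Prop) [DecidablePred P] (c : Fin 2 →₀ ℕ)
    (hP : ∀ m, P (c + m) ↔ P m) (q : Polynomial k) (f : MvPolynomial (Fin 2) k) :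
    termsOf P (Polynomial.aeval (monomial c (1 : k)) q * f) =
      Polynomial.aeval (monomial c (1 : k)) q * termsOf P f := by
  induction q using Polynomial.induction_on generalizing f with
  | C r =>
    rw [Polynomial.aeval_C, algebraMap_eq]
    ext m
    rw [coeff_termsOf, coeff_C_mul, coeff_C_mul, coeff_termsOf, mul_ite, mul_zero]
  | add p q hp hq => rw [map_add, add_mul, map_add, hp, hq, add_mul]
  | monomial n r h =>
    have e : Polynomial.aeval (monomial c (1 : k)) (Polynomial.C r * Polynomial.X ^ (n + 1)) =
        monomial c 1 * Polynomial.aeval (monomial c (1 : k)) (Polynomial.C r * Polynomial.X ^ n) := by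
      rw [pow_succ', mul_left_comm, map_mul, Polynomial.aeval_X]
    rw [e, mul_assoc, mul_assoc, ← h]
    generalize Polynomial.aeval (monomial c (1 : k)) (Polynomial.C r * Polynomial.X ^ n) * f = w
    ext m
    rw [coeff_termsOf, coeff_monomial_mul', coeff_monomial_mul']
    by_cases hc : c ≤ m
    · have := hP (m - c)
      rw [add_tsub_cancel_of_le hc] at this
      rw [if_pos hc, if_pos hc, coeff_termsOf]
      by_cases hm : P m
      · rw [if_pos hm, if_pos (this.1 hm)]
      · rw [if_neg hm, if_neg fun h => hm (this.2 h), mul_zero]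
    · simp [hc]

end Polynomial

section Ring

variable {k : Type*} [Field k] {d : ℕ} {M : Finset ℕ}

/-- If a multiple of `h` by a polynomial in a generator lies in the ring, then the exponents of `h`
are exponents of the ring up to powers of the generator. -/
theorem exists_isExp_of_aeval_mul_mem (hM : ∀ α ∈ M, α ≤ d) {α : ℕ} (hα : α ∈ M)
    {q : Polynomial k} (hq : Polynomial.aeval (mon k d α) q ≠ 0) {h : MvPolynomial (Fin 2) k}
    (hh : Polynomial.aeval (mon k d α) q * h ∈ ring k d M) :
    ∀ m ∈ h.support, ∃ N n : ℕ, IsExp d M n (N • expo d α + m) := by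
  classical
  -- The bad exponents, which no power of the generator brings into R. They are stable under shifts
  -- by the generator, so the bad part of h times the polynomial is the bad part of an element of R,
  -- which is zero.
  let P : (Fin 2 →₀ ℕ) → Prop := fun m => ¬ ∃ N n : ℕ, IsExp d M n (N • expo d α + m)
  have hP : ∀ m, P (expo d α + m) ↔ P m := by
    intro m
    refine not_congr ⟨?_, ?_⟩
    · rintro ⟨N, n, h⟩
      exact ⟨N + 1, n, by rwa [succ_nsmul, add_assoc]⟩
    · rintro ⟨N, n, h⟩
      have := (isExp_expo hM hα).add h
      rw [add_left_comm] at this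
      exact ⟨N, _, this⟩
  rw [mon_eq_monomial] at hq hh
  have h1 := termsOf_aeval_mul P (expo d α) hP q h
  have h2 : termsOf P (Polynomial.aeval (monomial (expo d α) (1 : k)) q * h) = 0 := by
    ext m
    rw [coeff_termsOf, coeff_zero, ite_eq_right_iff]
    intro hPm
    by_contra h0
    obtain ⟨n, hn⟩ := isExp_of_mem_ring hM hh m (mem_support_iff.2 h0)
    exact hPm ⟨0, n, by rwa [zero_smul, zero_add]⟩
  rw [h2] at h1
  have h3 := (mul_eq_zero.1 h1.symm).resolve_left hq
  intro m hm
  by_contra hPm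
  have := coeff_termsOf P h m
  rw [h3, if_pos hPm] at this
  exact mem_support_iff.1 hm this.symm

/-- A grid argument: the property is known on the column p = K and the row q = N, and spreads down
to the corner from the two neighbours of each point. -/
theorem descend {H : ℕ → ℕ → Prop} (hH : ∀ p q, H (p + 1) q → H p (q + 1) → H p q) (K : ℕ)
    (h1 : ∀ q, H K q) (N : ℕ) (h2 : ∀ p ≤ K, H p N) : H 0 0 := by
  induction N with
  | zero => exact h2 0 K.zero_le
  | succ N ih =>
    refine ih fun p hp => ?_
    obtain ⟨c, hc⟩ := Nat.exists_eq_add_of_le hp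
    induction c generalizing p with
    | zero => rw [add_zero] at hc; rw [← hc]; exact h1 N
    | succ c ihc => exact hH p N (ihc (p + 1) (by omega) (by omega)) (h2 p hp)

/-- A monomial brought into R by a power of x^d and also by a power of y^d already lies in R; this
globalizes the cancellation property. -/
theorem isExp_of_smul_add (hd : 0 < d) (hM0 : 0 ∈ M) (hMd : d ∈ M)
    (hcancel : ∀ n u, IsSum M (n + 1) u → IsSum M (n + 1) (u + d) → IsSum M n u)
    {m : Fin 2 →₀ ℕ} (h0 : ∃ N n : ℕ, IsExp d M n (N • expo d 0 + m))
    (h1 : ∃ N n : ℕ, IsExp d M n (N • expo d d + m)) : ∃ n, IsExp d M n m := by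
  obtain ⟨N, n, h0⟩ := h0
  obtain ⟨K, n', h1⟩ := h1
  have hn : m 0 + m 1 + N * d = n * d := by
    have := h0.1
    simp [expo_zero, expo_one] at this
    linarith
  obtain ⟨n₀, rfl⟩ : ∃ n₀, n = n₀ + N := by
    refine ⟨n - N, (Nat.sub_add_cancel ?_).symm⟩
    by_contra hlt
    have : (n + 1) * d ≤ N * d := Nat.mul_le_mul_right d (by omega)
    rw [Nat.succ_mul] at this
    omega
  have hn0 : m 0 + m 1 = n₀ * d := by rw [add_mul] at hn; omega
  obtain rfl : n' = n₀ + K := by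
    have := h1.1
    simp [expo_zero, expo_one] at this
    refine Nat.eq_of_mul_eq_mul_right hd ?_
    rw [add_mul]; linarith
  have e0 := h0.2
  have e1 := h1.2
  simp only [Finsupp.add_apply, Finsupp.smul_apply, expo_zero, smul_eq_mul, mul_zero,
    zero_add] at e0 e1
  have add0 : ∀ c {n u}, IsSum M n u → IsSum M (n + c) u := by
    intro c n u h
    induction c with
    | zero => exact h
    | succ c ih => exact ih.add (isSum_one hM0)
  have addd : ∀ c {n u}, IsSum M n u → IsSum M (n + c) (u + c * d) := by
    intro c n u h
    induction c with
    | zero => simpa using h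
    | succ c ih =>
      have := ih.add (isSum_one hMd)
      rwa [add_assoc u, ← Nat.succ_mul] at this
  refine ⟨n₀, hn0, ?_⟩
  -- The property at (p, q) says that x^(pd) y^(qd) times the monomial m lies in R.
  have key := descend (H := fun p q => IsSum M (n₀ + p + q) (m 0 + p * d)) ?_ K ?_ N ?_
  · simpa using key
  · intro p q h h'
    refine hcancel _ _ h' ?_
    have e : n₀ + p + q + 1 = n₀ + (p + 1) + q := by ring
    rw [e, add_assoc (m 0), ← Nat.succ_mul]
    exact h
  · intro q
    rw [add_comm (m 0)]
    exact add0 q e1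
  · intro p _
    have := addd p e0
    rwa [add_right_comm] at this

theorem aeval_gen_coe {α : ℕ} (h : α ∈ M) (q : Polynomial k) :
    ((Polynomial.aeval (gen h : ring k d M) q : ring k d M) : MvPolynomial (Fin 2) k) =
      Polynomial.aeval (mon k d α) q :=
  (Polynomial.aeval_algHom_apply (ring k d M).val (gen h) q).symm

theorem mon_d : mon k d d = X 0 ^ d := by simp [mon]

theorem mon_zero : mon k d 0 = X 1 ^ d := by simp [mon]

theorem aeval_X_pow_ne_zero (hd : 0 < d) (i : Fin 2) {q : Polynomial k} (hq : q ≠ 0) :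
    Polynomial.aeval (X i ^ d : MvPolynomial (Fin 2) k) q ≠ 0 :=
  fun h => hq (transcendental_iff.1 ((transcendental_X k i).pow hd) q h)

/-- Polynomials in `x ^ d` and `y ^ d` form a regular sequence. -/
theorem isWeaklyRegular_aeval (hd : 0 < d) (hM : ∀ α ∈ M, α ≤ d) (hM0 : 0 ∈ M) (hMd : d ∈ M)
    (hcancel : ∀ n u, IsSum M (n + 1) u → IsSum M (n + 1) (u + d) → IsSum M n u)
    {f g : Polynomial k} (hf : f ≠ 0) (hg : g ≠ 0) :
    RingTheory.Sequence.IsWeaklyRegular (ring k d M)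
      [Polynomial.aeval (gen hMd : ring k d M) f, Polynomial.aeval (gen hM0 : ring k d M) g] := by
  have hF : Polynomial.aeval (mon k d d) f ≠ 0 := by
    rw [mon_d]; exact aeval_X_pow_ne_zero hd 0 hf
  have hG : Polynomial.aeval (mon k d 0) g ≠ 0 := by
    rw [mon_zero]; exact aeval_X_pow_ne_zero hd 1 hg
  rw [RingTheory.Sequence.isWeaklyRegular_cons_iff,
    RingTheory.Sequence.isWeaklyRegular_singleton_iff]
  constructor
  · refine (IsRegular.of_ne_zero fun h => hF ?_).left.isSMulRegular
    rw [← aeval_gen_coe hMd, h]; rfl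
  · refine (isSMulRegular_quotient_iff_mem_of_smul_mem _ _).2 fun r hr => ?_
    rw [Submodule.mem_smul_pointwise_iff_exists] at hr ⊢
    obtain ⟨y, -, hy⟩ := hr
    have hy' : Polynomial.aeval (mon k d d) f * (y : MvPolynomial (Fin 2) k) =
        Polynomial.aeval (mon k d 0) g * (r : MvPolynomial (Fin 2) k) := by
      rw [← aeval_gen_coe hMd, ← aeval_gen_coe hM0]
      exact congrArg Subtype.val hy
    have hrel : IsRelPrime (Polynomial.aeval (mon k d d) f) (Polynomial.aeval (mon k d 0) g) := by
      rw [mon_d, mon_zero] at *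
      exact isRelPrime_aeval_pow f g hF hG
    -- In k[x, y] coprimality gives r = F h and y = G h, for the polynomials F in x^d and G in y^d.
    -- Both products lie in R, which forces h into R.
    obtain ⟨h, hh⟩ := hrel.dvd_of_dvd_mul_left (Dvd.intro _ hy')
    have hy2 : Polynomial.aeval (mon k d 0) g * h = y := by
      rw [hh, mul_left_comm] at hy'
      exact (mul_left_cancel₀ hF hy').symm
    have hmem : h ∈ ring k d M := mem_ring_of_isExp hM fun m hm =>
      isExp_of_smul_add hd hM0 hMd hcancel
        (exists_isExp_of_aeval_mul_mem hM hM0 hG (by rw [hy2]; exact y.2) m hm)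
        (exists_isExp_of_aeval_mul_mem hM hMd hF (by rw [← hh]; exact r.2) m hm)
    refine ⟨⟨h, hmem⟩, trivial, Subtype.ext ?_⟩
    rw [hh, ← aeval_gen_coe hMd]; rfl

instance : IsNoetherianRing (ring k d M) :=
  isNoetherianRing_of_surjective _ _ (presentation k d M).toRingHom presentation_surjective

instance : Algebra.FiniteType k (ring k d M) :=
  Algebra.FiniteType.of_surjective (presentation k d M) presentation_surjective

/-- A quotient in which `x ^ d` and `y ^ d` are integral is integral. -/
theorem isIntegral_of_gen (hd : 0 < d) (hM0 : 0 ∈ M) (hMd : d ∈ M)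
    {A : Type*} [CommRing A] [Algebra k A] (φ : ring k d M →ₐ[k] A) (hφ : Function.Surjective φ)
    (h0 : IsIntegral k (φ (gen hM0))) (h1 : IsIntegral k (φ (gen hMd))) :
    Algebra.IsIntegral k A := by
  refine ⟨fun z => ?_⟩
  obtain ⟨r, rfl⟩ := hφ z
  obtain ⟨q, rfl⟩ := presentation_surjective r
  induction q using MvPolynomial.induction_on with
  | C c =>
    rw [← algebraMap_eq, AlgHom.commutes, AlgHom.commutes]
    exact isIntegral_algebraMap
  | add p q hp hq => rw [map_add, map_add]; exact hp.add hq
  | mul_X p α hp =>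
    rw [map_mul, map_mul, presentation_X]
    refine hp.mul (IsIntegral.of_pow hd ?_)
    -- The d-th power of x^α y^(d-α) is a monomial in x^d and y^d.
    have : (gen α.2 : ring k d M) ^ d = gen hMd ^ (α : ℕ) * gen hM0 ^ (d - α) := by
      apply Subtype.ext
      change mon k d α ^ d = mon k d d ^ (α : ℕ) * mon k d 0 ^ (d - α)
      rw [mon_d, mon_zero, mon, mul_pow, ← pow_mul, ← pow_mul, ← pow_mul, ← pow_mul,
        mul_comm d (α : ℕ), mul_comm d (d - α)]
    rw [← map_pow, this, map_mul, map_pow, map_pow]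
    exact (h1.pow _).mul (h0.pow _)

/-- By the Nullstellensatz the residue field is finite over k. A maximal ideal other than R_+ need
not contain x^d or y^d, but it contains monic polynomials in them. -/
theorem exists_monic_aeval_mem (m : Ideal (ring k d M)) [m.IsMaximal] (r : ring k d M) :
    ∃ q : Polynomial k, q.Monic ∧ Polynomial.aeval r q ∈ m := by
  let := Ideal.Quotient.field m
  have : Module.Finite k (ring k d M ⧸ m) := finite_of_finite_type_of_isJacobsonRing k _
  obtain ⟨q, hq, h⟩ := IsIntegral.of_finite k (Ideal.Quotient.mkₐ k m r)
  refine ⟨q, hq, Ideal.Quotient.eq_zero_iff_mem.1 ?_⟩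
  rw [← Polynomial.aeval_def, Polynomial.aeval_algHom_apply] at h
  exact h

/-- The domain R/P is integral over k, hence a field. -/
theorem isMaximal_of_aeval_mem (hd : 0 < d) (hM0 : 0 ∈ M) (hMd : d ∈ M)
    {f g : Polynomial k} (hf : f.Monic) (hg : g.Monic) (P : Ideal (ring k d M)) [P.IsPrime]
    (h1 : Polynomial.aeval (gen hMd : ring k d M) f ∈ P)
    (h0 : Polynomial.aeval (gen hM0 : ring k d M) g ∈ P) : P.IsMaximal := by
  have aux : ∀ (r : ring k d M) (q : Polynomial k), q.Monic → Polynomial.aeval r q ∈ P →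
      IsIntegral k (Ideal.Quotient.mkₐ k P r) := by
    intro r q hq h
    refine ⟨q, hq, ?_⟩
    rw [← Polynomial.aeval_def, Polynomial.aeval_algHom_apply]
    exact Ideal.Quotient.eq_zero_iff_mem.2 h
  have := isIntegral_of_gen hd hM0 hMd (A := ring k d M ⧸ P) (Ideal.Quotient.mkₐ k P)
    (Ideal.Quotient.mkₐ_surjective k P) (aux _ _ hg h0) (aux _ _ hf h1)
  exact Ideal.Quotient.maximal_of_isField _
    (isField_of_isIntegral_of_isField' (S := ring k d M ⧸ P) (Field.toIsField k))

/-- A prime of the localization over the sequence contracts to a maximal ideal inside m, hence to m,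
so it is the maximal ideal. -/
theorem ringKrullDim_localization_quotient_eq_zero {R : Type*} [CommRing R] (m : Ideal R)
    [m.IsMaximal] {rs : List R} (hrs : ∀ r ∈ rs, r ∈ m)
    (h : ∀ (P : Ideal R) [P.IsPrime], (∀ r ∈ rs, r ∈ P) → P.IsMaximal) :
    ringKrullDim (Localization.AtPrime m ⧸
      Ideal.ofList (rs.map (algebraMap R (Localization.AtPrime m)))) = 0 := by
  have hnt : Nontrivial (Localization.AtPrime m ⧸
      Ideal.ofList (rs.map (algebraMap R (Localization.AtPrime m)))) := by
    refine Ideal.Quotient.nontrivial_iff.2 fun htop => ?_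
    have hle : Ideal.ofList (rs.map (algebraMap R (Localization.AtPrime m))) ≤
        IsLocalRing.maximalIdeal _ := by
      refine Ideal.span_le.2 fun x hx => ?_
      obtain ⟨r, hr, rfl⟩ := List.mem_map.1 hx
      exact (IsLocalization.AtPrime.to_map_mem_maximal_iff _ m r).2 (hrs r hr)
    rw [htop] at hle
    exact (IsLocalRing.maximalIdeal.isMaximal _).ne_top (top_le_iff.1 hle)
  rw [← ringKrullDimZero_iff_ringKrullDim_eq_zero,
    Ideal.krullDimLE_zero_quotient_iff_forall_minimalPrimes_isMaximal]
  intro J hJ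
  have hJp : J.IsPrime := hJ.1.1
  have hmax := h (J.comap (algebraMap R (Localization.AtPrime m))) fun r hr =>
    hJ.1.2 (Ideal.subset_span (List.mem_map_of_mem hr))
  have hJm : J ≤ IsLocalRing.maximalIdeal _ := IsLocalRing.le_maximalIdeal hJp.ne_top
  have heq : J.comap (algebraMap R (Localization.AtPrime m)) = m := by
    refine hmax.eq_of_le (Ideal.IsPrime.ne_top inferInstance) ?_
    have := Ideal.comap_mono (f := algebraMap R (Localization.AtPrime m)) hJm
    exact this.trans (Localization.AtPrime.under_maximalIdeal (I := m)).le
  have : J = IsLocalRing.maximalIdeal _ := by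
    refine le_antisymm hJm ?_
    rw [← Localization.AtPrime.map_eq_maximalIdeal]
    exact Ideal.map_le_iff_le_comap.2 heq.ge
  rw [this]
  infer_instance

/-- The ring is Cohen–Macaulay. -/
theorem isCohenMacaulayRing (hd : 0 < d) (hM : ∀ α ∈ M, α ≤ d) (hM0 : 0 ∈ M) (hMd : d ∈ M)
    (hcancel : ∀ n u, IsSum M (n + 1) u → IsSum M (n + 1) (u + d) → IsSum M n u) :
    IsCohenMacaulayRing (ring k d M) := by
  refine ⟨inferInstance, fun m _ => ?_⟩
  have hN : IsNoetherianRing (Localization.AtPrime m) :=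
    IsLocalization.isNoetherianRing m.primeCompl _ inferInstance
  refine ⟨hN, ?_⟩
  obtain ⟨f, hf, h1⟩ := exists_monic_aeval_mem m (gen hMd)
  obtain ⟨g, hg, h0⟩ := exists_monic_aeval_mem m (gen hM0)
  have hreg := (isWeaklyRegular_aeval hd hM hM0 hMd hcancel hf.ne_zero
    hg.ne_zero).isRegular_of_isLocalization_of_mem (Localization.AtPrime m) m (by
      simp only [List.mem_cons, List.not_mem_nil, or_false]
      rintro r (rfl | rfl)
      · exact h1
      · exact h0)
  refine ⟨_, hreg, ?_⟩
  -- Dividing by a regular sequence lowers the dimension by its length, and the quotient has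
  -- dimension zero.
  rw [← ringKrullDim_add_length_eq_ringKrullDim_of_isRegular _ hreg,
    ringKrullDim_localization_quotient_eq_zero m, zero_add]
  · rfl
  · simp only [List.mem_cons, List.not_mem_nil, or_false]
    rintro r (rfl | rfl)
    · exact h1
    · exact h0
  · exact fun P _ hP => isMaximal_of_aeval_mem hd hM0 hMd hf hg P (hP _ (by simp)) (hP _ (by simp))

end Ring

end MonomialCurve

/-! ### The theorem -/

theorem mainTheorem1 (k : Type*) [Field k] (a b d : ℕ) (ha : 2 ≤ a) (hab : a < b)
    (hbd : (b : ℤ) ≤ (d : ℤ) - 2) :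
    IsCohenMacaulayRing (MonomialCurve.ring k d (MonomialCurve.exponents a b d)) ∧
    (2 * (a : ℤ) - 1 ≤ (b : ℤ) →
      MonomialCurve.IsReg k d (MonomialCurve.exponents a b d) ⌈((a : ℚ) + d - 1) / b⌉ ∧
      ∃ r : ℕ, (r : ℤ) = ⌈((a : ℚ) + d - 1) / b⌉ ∧
        MonomialCurve.IsRedNumber k d (MonomialCurve.exponents a b d) r) ∧
    ((3 * (a : ℚ) - 1) / 2 ≤ (b : ℚ) → (b : ℚ) < 2 * (a : ℚ) - 1 →
      MonomialCurve.IsReg k d (MonomialCurve.exponents a b d) ⌈(2 * (a : ℚ) + d - 1) / b⌉ ∧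
      ∃ r : ℕ, (r : ℤ) = ⌈(2 * (a : ℚ) + d - 1) / b⌉ ∧
        MonomialCurve.IsRedNumber k d (MonomialCurve.exponents a b d) r) := by
  have hbd' : b + 2 ≤ d := by omega
  refine ⟨?_, fun h => ?_, fun h h' => ?_⟩
  · exact MonomialCurve.isCohenMacaulayRing (by omega)
      (MonomialCurve.mem_exponents_le (by omega)) (by simp [MonomialCurve.exponents])
      (by simp [MonomialCurve.exponents]) (MonomialCurve.exponents_cancel hab (by omega))
  · obtain ⟨f, h1, h2, h3⟩ := MonomialCurve.exists_ceil_eq (N := a + d - 1) (b := b)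
      (by omega) (by omega)
    have hcast : ((a + d - 1 : ℕ) : ℚ) = (a : ℚ) + d - 1 := by
      rw [Nat.cast_sub (by omega)]; push_cast; ring
    rw [hcast] at h3
    have T := MonomialCurve.hasTopDegree_of_two_mul_le ha hab hbd' (by omega) (f := f)
      (by omega) (by omega)
    rw [h3]
    exact ⟨T.isReg k, _, rfl, T.isRedNumber k⟩
  · have h4 : 3 * a ≤ 2 * b + 1 := by
      have : (3 * a : ℚ) ≤ 2 * b + 1 := by linarith
      exact_mod_cast this
    have h5 : b + 1 < 2 * a := by
      have : (b + 1 : ℚ) < 2 * a := by linarith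
      exact_mod_cast this
    obtain ⟨f, h1, h2, h3⟩ := MonomialCurve.exists_ceil_eq (N := 2 * a + d - 1) (b := b)
      (by omega) (by omega)
    have hcast : ((2 * a + d - 1 : ℕ) : ℚ) = 2 * (a : ℚ) + d - 1 := by
      rw [Nat.cast_sub (by omega)]; push_cast; ring
    rw [hcast] at h3
    have T := MonomialCurve.hasTopDegree_of_three_mul_le ha hab hbd' h4 h5 (f := f)
      (by omega) (by omega)
    rw [h3]
    exact ⟨T.isReg k, _, rfl, T.isRedNumber k⟩
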